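/- Let $N\ge 3$, $\alpha\in\mathbb R$, and let $\theta\in C_c^\infty(\mathbb R^N)$ satisfy $0\le\theta\le 1$, $\theta=1$ on $B_{1/2}$ and $\theta=0$ on $\mathbb R^N\setminus B_1$, where $B_r=\{|x|<r\}$. Put $c_0(N)=\left(\frac{N-2}{2}\right)^2$ and $d\mu=\mu(x)\,dx$ with $$\mu(x)=\theta(x)\left(\log\frac1{|x|}\right)^{\alpha}$$ (understood as $0$ for $|x|\ge 1$). Let $H^1_\mu$ be the space of real functions $u\in L^1_{loc}(\mathbb R^N)\cap L^2(\mathbb R^N,d\mu)$ whose weak gradient $\nabla u$ on $\mathbb R^N$ is in $L^1_{loc}$ and belongs to $L^2(\mathbb R^N,d\mu)$. For real $c,C$ consider the weighted Hardy inequality $$c\int_{\mathbb R^N}\frac{u^2}{|x|^2}\,d\mu\le\int_{\mathbb R^N}|\nabla u|^2\,d\mu+C\int_{\mathbb R^N}u^2\,d\mu\qquad\text{for all }u\in H^1_\mu .\tag{$*$}$$ Then $\int_{\mathbb R^N} u^2/|x|^2\,d\mu<\infty$ for every $u\in H^1_\mu$, and: - If $\alpha\le 0$, there is a constant $C\ge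 0$ such that $(*)$ holds with $c=c_0(N)$; and $c_0(N)$ is the best constant: for no $c>c_0(N)$ is there a $C\in\mathbb R$ such that $(*)$ holds. - If $\alpha>0$, then for every $c<c_0(N)$ there is a constant $C\ge 0$ (depending on $c$) such that $(*)$ holds; and $c_0(N)$ is the best constant but is not attained: for no $c\ge c_0(N)$ is there a $C\in\mathbb R$ such that $(*)$ holds. -/

import Mathlib

open MeasureTheory
open scoped ContDiff

noncomputable section

/-- `G` is the weak (distributional) gradient of `u` on `ℝ^N`: both are locally integrable for
Lebesgue measure and `∫ u ∂_v φ dx = - ∫ (G · v) φ dx` for every test function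
`φ ∈ C_c^∞(ℝ^N)` and every direction `v`. -/
def IsWeakGradient {N : ℕ} (u : EuclideanSpace ℝ (Fin N) → ℝ)
    (G : EuclideanSpace ℝ (Fin N) → EuclideanSpace ℝ (Fin N)) : Prop :=
  LocallyIntegrable u volume ∧ LocallyIntegrable G volume ∧
    ∀ φ : EuclideanSpace ℝ (Fin N) → ℝ, ContDiff ℝ ∞ φ → HasCompactSupport φ →
      ∀ v : EuclideanSpace ℝ (Fin N),
        ∫ x, u x * fderiv ℝ φ x v = - ∫ x, inner ℝ (G x) v * φ x

/-- `u` belongs to the weighted Sobolev space `H^1_μ = H^1(ℝ^N, dμ)`, with weak gradient `G`: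
`u` and `∇u = G` belong to `L^2_μ`. -/
def MemWeightedH1 {N : ℕ} (μ : Measure (EuclideanSpace ℝ (Fin N)))
    (u : EuclideanSpace ℝ (Fin N) → ℝ)
    (G : EuclideanSpace ℝ (Fin N) → EuclideanSpace ℝ (Fin N)) : Prop :=
  IsWeakGradient u G ∧ MemLp u 2 μ ∧ MemLp G 2 μ

/-- The weighted Hardy inequality
`c ∫ u² / |x|² dμ ≤ ∫ |∇u|² dμ + C ∫ u² dμ` for all `u ∈ H^1_μ`. -/
def WeightedHardy {N : ℕ} (μ : Measure (EuclideanSpace ℝ (Fin N))) (c C : ℝ) : Prop :=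
  ∀ (u : EuclideanSpace ℝ (Fin N) → ℝ)
    (G : EuclideanSpace ℝ (Fin N) → EuclideanSpace ℝ (Fin N)),
    MemWeightedH1 μ u G →
      c * ∫ x, u x ^ 2 / ‖x‖ ^ 2 ∂μ ≤ (∫ x, ‖G x‖ ^ 2 ∂μ) + C * ∫ x, u x ^ 2 ∂μ

/-- The classical Hardy constant `c₀(N) = ((N - 2) / 2)²`. -/
def hardyConst (N : ℕ) : ℝ := (((N : ℝ) - 2) / 2) ^ 2

/-- The density `θ(x) (log (1 / |x|))^α`. -/
def logDensity {N : ℕ} (θ : EuclideanSpace ℝ (Fin N) → ℝ) (α : ℝ)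
    (x : EuclideanSpace ℝ (Fin N)) : ℝ :=
  θ x * Real.log (1 / ‖x‖) ^ α

/-- The measure `dμ = θ(x) (log (1 / |x|))^α dx`. -/
def logMeasure {N : ℕ} (θ : EuclideanSpace ℝ (Fin N) → ℝ) (α : ℝ) :
    Measure (EuclideanSpace ℝ (Fin N)) :=
  (volume : Measure (EuclideanSpace ℝ (Fin N))).withDensity
    fun x => ENNReal.ofReal (logDensity θ α x)

end

/-! Write s = log(1/|x|) and k = (N-2)/2, so that `hardyConst N` is k².

Upper half. For a profile a(s), expand 0 ≤ ∫ |G + u a(s) x/|x|²|² dμ. The cross term is a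
divergence: u² has weak gradient 2uG away from the origin, and testing against the weight times a(s)
x/|x|² gives ∫ u² V(s)/|x|² dμ ≤ ∫ |G|² dμ with V = (N-2)a - a' - αa/s - a². For a = k this is V =
k² - αk/s, so the sign of α decides everything: V ≥ k² when α ≤ 0, while for α > 0 one only has V ≥
c for large s, for each c < k². The constant profile must be cut off. Near s = 1 the cutoff costs a
bounded amount on a region away from the origin, which the term C ∫ u² dμ pays for; near s = n the
profile decreases, and -a' has the favourable sign. Hence C does not depend on n, and Fatou's lemma
as n → ∞ yields both the finiteness of ∫ u²/|x|² dμ and the inequality. No density of smooth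
functions is used. The carrying lemmas are `HasWeakLineDeriv.sq`,
`MemWeightedH1.integral_sq_mul_hardyPotential_le` and `exists_le_hardyPotential_hardyProfile`.

Sharpness. Testing with u = |x|^{-k} g(s) turns the inequality into c ∫ g² s^α ≤ ∫ (kg + g')² s^α +
C ∫ g² s^α e^{-2s}. For g(s) = h(s/l), integrating 2k g g' s^α by parts produces -kα ∫ g² s^{α-1},
of relative size 1/l, while the other errors are O(1/l²). So (c - k²) A l² + kαB l ≤ M for all l ≥
1, with A, B > 0 (`WeightedHardy.exists_quadratic_bound`). Letting l grow forces c ≤ k², and c < k²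
if α > 0. -/

/-! ### Chain rule for the square of a weakly differentiable function. -/

section WeakLineDeriv

open Filter Topology

variable {E : Type*} [NormedAddCommGroup E] [InnerProductSpace ℝ E] [FiniteDimensional ℝ E]
  [MeasurableSpace E] [BorelSpace E]

/-- `g` is the distributional derivative of `u` in the direction `v`. -/
def HasWeakLineDeriv (u g : E → ℝ) (v : E) : Prop :=
  ∀ φ : E → ℝ, ContDiff ℝ ∞ φ → HasCompactSupport φ →
    ∫ x, u x * fderiv ℝ φ x v = - ∫ x, g x * φ x

/-- Translations act continuously on L², and the integral is an L² inner product with a translate.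
-/
lemma continuous_integral_mul_translate {A B : E → ℝ} (hA : MemLp A 2 volume)
    (hB : MemLp B 2 volume) : Continuous fun z => ∫ x, A x * B (z + x) := by
  have : Fact ((2 : ENNReal) ≠ ⊤) := ⟨by simp⟩
  have h : Continuous fun z : E =>
      inner ℝ (hA.toLp A) (DomAddAct.mk z +ᵥ hB.toLp B) := by
    refine continuous_const.inner ?_
    exact DomAddAct.continuous_mk.vadd continuous_const
  refine h.congr fun z => ?_
  rw [L2.inner_def]
  refine integral_congr_ae ?_
  filter_upwards [hA.coeFn_toLp, DomAddAct.vadd_Lp_ae_eq (DomAddAct.mk z) (hB.toLp B),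
    (measurePreserving_add_left (volume : Measure E) z).quasiMeasurePreserving.ae
      hB.coeFn_toLp] with x h1 h2 h3
  rw [h1, h2]
  simp [h3, mul_comm]

lemma integrable_mul_mul_kernel {A B k : E → ℝ} (hA : Integrable A) (hB : Integrable B)
    (hk : Continuous k) (hkc : HasCompactSupport k) :
    Integrable (fun p : E × E => A p.1 * (B p.2 * k (p.1 - p.2))) (volume.prod volume) := by
  obtain ⟨M, hM⟩ := hk.bounded_above_of_compact_support hkc
  have h : Integrable (fun p : E × E => A p.1 * B p.2 * k (p.1 - p.2))
      (volume.prod volume) :=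
    (hA.mul_prod hB).mul_bdd
      (hk.comp (continuous_fst.sub continuous_snd)).aestronglyMeasurable
      (ae_of_all _ fun p => hM _)
  exact h.congr (ae_of_all _ fun p => mul_assoc _ _ _)

lemma integrable_mul_integral_kernel {A B k : E → ℝ} (hA : Integrable A) (hB : Integrable B)
    (hk : Continuous k) (hkc : HasCompactSupport k) :
    Integrable fun y => B y * ∫ x, A x * k (x - y) := by
  simp_rw [← integral_const_mul, mul_left_comm]
  exact (integrable_mul_mul_kernel hA hB hk hkc).integral_prod_right

lemma integral_mul_integral_kernel_comm {A B k : E → ℝ} (hA : Integrable A) (hB : Integrable B)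
    (hk : Continuous k) (hkc : HasCompactSupport k) :
    ∫ x, A x * ∫ y, B y * k (x - y) = ∫ y, B y * ∫ x, A x * k (x - y) := by
  simp_rw [← integral_const_mul]
  rw [integral_integral_swap (integrable_mul_mul_kernel hA hB hk hkc)]
  simp_rw [mul_left_comm]

/-- The double integral is an average, with weight the bump, of the continuous correlation z ↦ ∫
A(x) B(z + x) near z = 0. Mollifying inside a bilinear expression in this way avoids proving L²
convergence of the mollified function. -/
lemma tendsto_integral_mul_integral_normed {A B : E → ℝ} (hA : Integrable A) (hB : Integrable B)
    (hA2 : MemLp A 2 volume) (hB2 : MemLp B 2 volume) {ρ : ℕ → ContDiffBump (0 : E)}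
    (hρ : Tendsto (fun n => (ρ n).rOut) atTop (𝓝 0)) :
    Tendsto (fun n => ∫ x, A x * ∫ y, B y * (ρ n).normed volume (x - y)) atTop
      (𝓝 (∫ x, A x * B x)) := by
  have h := ContDiffBump.convolution_tendsto_right_of_continuous (μ := (volume : Measure E)) hρ
    (continuous_integral_mul_translate hA2 hB2) 0
  simp only [zero_add] at h
  refine h.congr fun n => ?_
  rw [convolution_def]
  have hint : Integrable (fun p : E × E => (ρ n).normed volume p.1 * (A p.2 * B (-p.1 + p.2)))
      (volume.prod volume) := by
    have h0 := integrable_mul_mul_kernel hA hB (ρ n).continuous_normed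
      ((ρ n).hasCompactSupport_normed (μ := volume))
    -- This is the measure-preserving change of variables (z, x) ↦ (x, x - z).
    have hT := Measure.measurePreserving_swap.comp
      ((measurePreserving_prod_add_swap (volume : Measure E) (volume : Measure E)).comp
        (measurePreserving_prod_neg_add (volume : Measure E) (volume : Measure E)))
    refine (hT.integrable_comp_of_integrable h0).congr (ae_of_all _ fun p => ?_)
    simp only [Function.comp_apply, Prod.swap_prod_mk]
    rw [show -p.1 + p.2 + p.1 = p.2 by abel, show p.2 - (-p.1 + p.2) = p.1 by abel]
    ring
  simp only [zero_sub, ContinuousLinearMap.lsmul_apply, smul_eq_mul]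
  simp_rw [← integral_const_mul]
  rw [integral_integral_swap hint]
  congr 1 with x
  rw [← integral_sub_left_eq_self _ volume x]
  congr 1 with y
  simp
  ring_nf

/-- The chain rule for the square of a function with a weak derivative. -/
lemma HasWeakLineDeriv.sq {u g : E → ℝ} {v : E} (h : HasWeakLineDeriv u g v)
    (hu : Integrable u) (hg : Integrable g) (hu2 : MemLp u 2 volume) (hg2 : MemLp g 2 volume)
    {φ : E → ℝ} (hφ : ContDiff ℝ ∞ φ) (hφc : HasCompactSupport φ) :
    ∫ x, u x ^ 2 * fderiv ℝ φ x v = - ∫ x, 2 * (u x * g x * φ x) := by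
  have hDφ : Continuous fun x => fderiv ℝ φ x v :=
    (hφ.continuous_fderiv (by simp)).clm_apply continuous_const
  have hDφc : HasCompactSupport fun x => fderiv ℝ φ x v := hφc.fderiv_apply (𝕜 := ℝ) v
  have bdd : ∀ {k : E → ℝ}, Continuous k → HasCompactSupport k → MemLp k ⊤ volume := by
    intro k hk hkc
    exact hk.memLp_of_hasCompactSupport hkc
  have int : ∀ {w k : E → ℝ}, Integrable w → Continuous k → HasCompactSupport k →
      Integrable fun x => w x * k x := by
    intro w k hw hk hkc
    obtain ⟨M, hM⟩ := hk.bounded_above_of_compact_support hkc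
    exact hw.mul_bdd hk.aestronglyMeasurable (ae_of_all _ hM)
  have lp : ∀ {w k : E → ℝ}, MemLp w 2 volume → Continuous k → HasCompactSupport k →
      MemLp (fun x => w x * k x) 2 volume := by
    intro w k hw hk hkc
    exact (bdd hk hkc).mul' hw
  let ρ : ℕ → ContDiffBump (0 : E) := fun n =>
    ⟨1 / (n + 2), 1 / (n + 1), by positivity, by gcongr; linarith⟩
  have hρ : Tendsto (fun n => (ρ n).rOut) atTop (𝓝 0) := tendsto_one_div_add_atTop_nhds_zero_nat
  have t1 := tendsto_integral_mul_integral_normed (int hu hDφ hDφc) hu (lp hu2 hDφ hDφc) hu2 hρ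
  have t2 := tendsto_integral_mul_integral_normed (int hu hφ.continuous hφc) hg
    (lp hu2 hφ.continuous hφc) hg2 hρ
  have t3 := tendsto_integral_mul_integral_normed (int hg hφ.continuous hφc) hu
    (lp hg2 hφ.continuous hφc) hu2 hρ
  -- The product rule with one factor mollified. The mollification of g is u against the derivative
  -- of the kernel, so after exchanging integrals it suffices, for each fixed y, to test the weak
  -- derivative of u with x ↦ φ(x) k(x - y).
  have key : ∀ n, (∫ x, (u x * fderiv ℝ φ x v) * ∫ y, u y * (ρ n).normed volume (x - y)) +
      (∫ x, (u x * φ x) * ∫ y, g y * (ρ n).normed volume (x - y)) =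
      - ∫ x, (g x * φ x) * ∫ y, u y * (ρ n).normed volume (x - y) := by
    intro n
    set k : E → ℝ := (ρ n).normed volume with hk_def
    have hk : ContDiff ℝ ∞ k := (ρ n).contDiff_normed
    have hkc : HasCompactSupport k := (ρ n).hasCompactSupport_normed
    have hDk : Continuous fun x => fderiv ℝ k x v :=
      (hk.continuous_fderiv (by simp)).clm_apply continuous_const
    have hDkc : HasCompactSupport fun x => fderiv ℝ k x v := hkc.fderiv_apply (𝕜 := ℝ) v
    have e2 : ∀ x, ∫ y, g y * k (x - y) = ∫ y, u y * fderiv ℝ k (x - y) v := by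
      intro x
      have := h (fun y => k (x - y)) (hk.comp (by fun_prop))
        (hkc.comp_homeomorph (Homeomorph.subLeft x))
      have hd : ∀ y, fderiv ℝ (fun y => k (x - y)) y v = - fderiv ℝ k (x - y) v := by
        intro y
        have h1 := ((hk.differentiable (by simp) (x - y)).hasFDerivAt).comp y
          ((hasFDerivAt_id y).const_sub x)
        simpa [Function.comp_def] using congrArg (fun T : E →L[ℝ] ℝ => T v) h1.fderiv
      simp_rw [hd] at this
      simpa [integral_neg] using this.symm
    simp_rw [e2]
    rw [integral_mul_integral_kernel_comm (int hu hDφ hDφc) hu hk.continuous hkc,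
      integral_mul_integral_kernel_comm (int hu hφ.continuous hφc) hu hDk hDkc,
      integral_mul_integral_kernel_comm (int hg hφ.continuous hφc) hu hk.continuous hkc]
    have i1 := integrable_mul_integral_kernel (int hu hDφ hDφc) hu hk.continuous hkc
    have i2 := integrable_mul_integral_kernel (int hu hφ.continuous hφc) hu hDk hDkc
    rw [← integral_add i1 i2, ← integral_neg]
    congr 1 with y
    have hT := h (fun x => φ x * k (x - y)) (hφ.mul (hk.comp (by fun_prop))) hφc.mul_right
    have hd : ∀ x, fderiv ℝ (fun x => φ x * k (x - y)) x v =
        fderiv ℝ φ x v * k (x - y) + φ x * fderiv ℝ k (x - y) v := by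
      intro x
      have h1 := ((hk.differentiable (by simp) (x - y)).hasFDerivAt).comp x
          ((hasFDerivAt_id x).sub_const y)
      have h2 := ((hφ.differentiable (by simp) x).hasFDerivAt).mul h1
      have h3 := congrArg (fun T : E →L[ℝ] ℝ => T v) h2.fderiv
      simp only [Function.comp_def, id] at h3
      refine h3.trans ?_
      simp
      ring
    have hsh : Continuous fun x : E => x - y := by fun_prop
    have hkc' : HasCompactSupport fun x => k (x - y) :=
      hkc.comp_homeomorph (Homeomorph.subRight y)
    have j1 : Integrable fun x => (u x * fderiv ℝ φ x v) * k (x - y) :=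
      int (int hu hDφ hDφc) (hk.continuous.comp hsh) hkc'
    have j2 : Integrable fun x => (u x * φ x) * fderiv ℝ k (x - y) v :=
      int (int hu hφ.continuous hφc) (hDk.comp hsh) (hDkc.comp_homeomorph (Homeomorph.subRight y))
    have e : (∫ x, u x * fderiv ℝ φ x v * k (x - y)) + ∫ x, u x * φ x * fderiv ℝ k (x - y) v
        = - ∫ x, g x * φ x * k (x - y) := by
      rw [← integral_add j1 j2]
      simp_rw [hd] at hT
      calc _ = _ := by congr 1 with x; ring
        _ = _ := hT
        _ = _ := by simp_rw [mul_assoc]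
    rw [← mul_add, e, mul_neg]
  have hlim := tendsto_nhds_unique ((t1.add t2).congr key) t3.neg
  have p1 : Integrable fun x => u x * φ x * g x :=
    (lp hu2 hφ.continuous hφc).integrable_mul hg2
  have e1 : ∫ x, u x ^ 2 * fderiv ℝ φ x v = ∫ x, u x * fderiv ℝ φ x v * u x := by
    congr 1 with x; ring
  have e2 : ∫ x, 2 * (u x * g x * φ x) = (∫ x, u x * φ x * g x) + ∫ x, g x * φ x * u x := by
    rw [← integral_add p1 (p1.congr (ae_of_all _ fun x => by ring))]
    congr 1 with x; ring
  rw [e1, e2]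
  linarith

/-- Multiplication of a weak derivative by a test function. -/
lemma HasWeakLineDeriv.mul_test {u g ζ : E → ℝ} {v : E} (h : HasWeakLineDeriv u g v)
    (hu : LocallyIntegrable u) (hg : LocallyIntegrable g)
    (hζ : ContDiff ℝ ∞ ζ) (hζc : HasCompactSupport ζ) :
    HasWeakLineDeriv (fun x => ζ x * u x) (fun x => ζ x * g x + fderiv ℝ ζ x v * u x) v := by
  intro φ hφ hφc
  have hT := h (fun x => ζ x * φ x) (hζ.mul hφ) hζc.mul_right
  have hd : ∀ x, fderiv ℝ (fun x => ζ x * φ x) x v =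
      ζ x * fderiv ℝ φ x v + φ x * fderiv ℝ ζ x v := by
    intro x
    simp [fderiv_fun_mul (hζ.differentiable (by simp) x) (hφ.differentiable (by simp) x)]
  have hD : ∀ {f : E → ℝ}, ContDiff ℝ ∞ f → Continuous fun x => fderiv ℝ f x v := fun hf =>
    (hf.continuous_fderiv (by simp)).clm_apply continuous_const
  have int : ∀ {w k : E → ℝ}, LocallyIntegrable w → Continuous k → HasCompactSupport k →
      Integrable fun x => w x * k x := by
    intro w k hw hk hkc
    simpa [mul_comm] using hw.integrable_smul_left_of_hasCompactSupport hk hkc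
  have i1 : Integrable fun x => u x * (ζ x * fderiv ℝ φ x v) :=
    int hu (hζ.continuous.mul (hD hφ)) hζc.mul_right
  have i2 : Integrable fun x => u x * (φ x * fderiv ℝ ζ x v) :=
    int hu (hφ.continuous.mul (hD hζ)) hφc.mul_right
  have i3 : Integrable fun x => g x * (ζ x * φ x) :=
    int hg (hζ.continuous.mul hφ.continuous) hζc.mul_right
  simp_rw [hd, mul_add] at hT
  rw [integral_add i1 i2] at hT
  have e1 : ∫ x, (ζ x * g x + fderiv ℝ ζ x v * u x) * φ x =
      (∫ x, g x * (ζ x * φ x)) + ∫ x, u x * (φ x * fderiv ℝ ζ x v) := by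
    rw [← integral_add i3 i2]
    congr 1 with x; ring
  have e2 : ∫ x, ζ x * u x * fderiv ℝ φ x v = ∫ x, u x * (ζ x * fderiv ℝ φ x v) := by
    congr 1 with x; ring
  rw [e1, e2]
  linarith

/-- The chain rule for the square of a function with a weak derivative that is locally square
integrable near the support of the test function. -/
lemma HasWeakLineDeriv.sq_of_memLp_restrict {u g : E → ℝ} {v : E} (h : HasWeakLineDeriv u g v)
    (hu : LocallyIntegrable u) (hg : LocallyIntegrable g) {U : Set E} (hU : IsOpen U)
    (hu2 : MemLp u 2 (volume.restrict U)) (hg2 : MemLp g 2 (volume.restrict U))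
    {φ : E → ℝ} (hφ : ContDiff ℝ ∞ φ) (hφc : HasCompactSupport φ) (hφU : tsupport φ ⊆ U) :
    ∫ x, u x ^ 2 * fderiv ℝ φ x v = - ∫ x, 2 * (u x * g x * φ x) := by
  obtain ⟨V, hV, hφV, hVU⟩ := exists_compact_between hφc.isCompact hU hφU
  -- Localisation: ζu satisfies the global hypotheses of `HasWeakLineDeriv.sq`, and nothing changes
  -- on the support of φ because ζ = 1 in a neighbourhood of it.
  obtain ⟨ζ, hζ1, hζ0, -⟩ := exists_contMDiffMap_one_nhds_of_subset_interior (n := (⊤ : ℕ∞))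
    (modelWithCornersSelf ℝ E) (isClosed_tsupport φ) hφV
  have hζ : ContDiff ℝ ∞ ζ := ζ.contMDiff.contDiff
  have hζV : tsupport ζ ⊆ V := closure_minimal
    (fun x hx => by_contra fun hxV => hx (hζ0 x hxV)) hV.isClosed
  have hζc : HasCompactSupport ζ := HasCompactSupport.of_support_subset_isCompact hV
    (subset_closure.trans hζV)
  have hD : Continuous fun x => fderiv ℝ ζ x v :=
    (hζ.continuous_fderiv (by simp)).clm_apply continuous_const
  have hDc : HasCompactSupport fun x => fderiv ℝ ζ x v := hζc.fderiv_apply (𝕜 := ℝ) v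
  have hDV : ∀ x ∉ V, fderiv ℝ ζ x v = 0 := fun x hx => by
    have h0 : fderiv ℝ ζ x = 0 :=
      image_eq_zero_of_notMem_tsupport fun hx' => hx (hζV (tsupport_fderiv_subset ℝ hx'))
    simp [h0]
  have int : ∀ {w k : E → ℝ}, LocallyIntegrable w → Continuous k → HasCompactSupport k →
      Integrable fun x => k x * w x := by
    intro w k hw hk hkc
    exact hw.integrable_smul_left_of_hasCompactSupport hk hkc
  have lp : ∀ {w k : E → ℝ}, MemLp w 2 (volume.restrict U) → Continuous k →
      HasCompactSupport k → (∀ x ∉ V, k x = 0) → MemLp (fun x => k x * w x) 2 volume := by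
    intro w k hw hk hkc hk0
    refine MemLp.ae_eq (ae_of_all _ fun x => ?_) (((memLp_indicator_iff_restrict
      hU.measurableSet).2 hw).mul' (hk.memLp_of_hasCompactSupport hkc (p := ⊤)))
    by_cases hx : x ∈ U
    · simp [hx]
    · simp [hx, hk0 x fun h => hx (hVU h)]
  have key := (h.mul_test hu hg hζ hζc).sq (int hu hζ.continuous hζc)
    ((int hg hζ.continuous hζc).add (int hu hD hDc)) (lp hu2 hζ.continuous hζc hζ0)
    ((lp hg2 hζ.continuous hζc hζ0).add (lp hu2 hD hDc hDV)) hφ hφc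
  have hon : ∀ x ∈ tsupport φ, ζ x = 1 ∧ fderiv ℝ ζ x v = 0 := by
    intro x hx
    have h1 : ζ =ᶠ[𝓝 x] fun _ => (1 : ℝ) := hζ1.filter_mono (nhds_le_nhdsSet hx)
    refine ⟨h1.self_of_nhds, ?_⟩
    rw [h1.fderiv_eq]
    simp
  have e1 : ∀ x, (ζ x * u x) ^ 2 * fderiv ℝ φ x v = u x ^ 2 * fderiv ℝ φ x v := by
    intro x
    by_cases hx : x ∈ tsupport φ
    · rw [(hon x hx).1, one_mul]
    · have h0 : fderiv ℝ φ x = 0 :=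
        image_eq_zero_of_notMem_tsupport fun hx' => hx (tsupport_fderiv_subset ℝ hx')
      simp [h0]
  have e2 : ∀ x, ζ x * u x * (ζ x * g x + fderiv ℝ ζ x v * u x) * φ x = u x * g x * φ x := by
    intro x
    by_cases hx : x ∈ tsupport φ
    · rw [(hon x hx).1, (hon x hx).2]
      ring
    · rw [image_eq_zero_of_notMem_tsupport hx]
      simp
  simpa only [e1, e2] using key

end WeakLineDeriv

/-! ### Smooth functions of log |x|. -/

section RadialFunctions

open Filter Topology

variable {E : Type*} [NormedAddCommGroup E]

/-- Since `Real.log 0 = 0`, the value at the origin is the spurious χ(0); the condition χ(0) = 0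
makes it agree with the values nearby, where log |x| has left the support of χ. -/
lemma tsupport_comp_log_norm_subset {χ : ℝ → ℝ} (h0 : χ 0 = 0) (hc : HasCompactSupport χ) :
    tsupport (fun x : E => χ (Real.log ‖x‖)) ⊆ (fun x => ‖x‖) ⁻¹' (Real.exp '' tsupport χ) := by
  refine closure_minimal (fun x hx => ?_)
    ((hc.isCompact.image Real.continuous_exp).isClosed.preimage continuous_norm)
  have hx0 : x ≠ 0 := by
    rintro rfl
    simp [h0] at hx
  exact ⟨Real.log ‖x‖, subset_closure hx, Real.exp_log (norm_pos_iff.2 hx0)⟩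

lemma hasCompactSupport_comp_log_norm [NormedSpace ℝ E] [FiniteDimensional ℝ E] {χ : ℝ → ℝ}
    (h0 : χ 0 = 0) (hc : HasCompactSupport χ) : HasCompactSupport fun x : E => χ (Real.log ‖x‖) := by
  obtain ⟨R, hR⟩ := (hc.isCompact.image Real.continuous_exp).isBounded.subset_closedBall 0
  refine (isCompact_closedBall (0 : E) R).of_isClosed_subset (isClosed_tsupport _) fun x hx => ?_
  have := hR (tsupport_comp_log_norm_subset h0 hc hx)
  simpa using this

lemma eventuallyEq_comp_log_norm_zero {χ : ℝ → ℝ} (h0 : χ 0 = 0) (hc : HasCompactSupport χ) :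
    (fun x : E => χ (Real.log ‖x‖)) =ᶠ[𝓝 0] fun _ => 0 := by
  refine notMem_tsupport_iff_eventuallyEq.1 fun h => ?_
  obtain ⟨t, -, ht⟩ := tsupport_comp_log_norm_subset h0 hc h
  simp at ht

variable [InnerProductSpace ℝ E]

lemma contDiff_comp_log_norm {χ : ℝ → ℝ} (hχ : ContDiff ℝ ∞ χ) (h0 : χ 0 = 0)
    (hc : HasCompactSupport χ) : ContDiff ℝ ∞ fun x : E => χ (Real.log ‖x‖) := by
  rw [contDiff_iff_contDiffAt]
  intro x
  rcases eq_or_ne x 0 with rfl | hx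
  · exact contDiffAt_const.congr_of_eventuallyEq (eventuallyEq_comp_log_norm_zero h0 hc)
  · exact hχ.contDiffAt.comp x ((contDiffAt_norm ℝ hx).log (norm_ne_zero_iff.2 hx))

lemma fderiv_comp_log_norm {χ : ℝ → ℝ} (hχ : Differentiable ℝ χ) (h0 : χ 0 = 0)
    (hc : HasCompactSupport χ) (x v : E) :
    fderiv ℝ (fun x : E => χ (Real.log ‖x‖)) x v =
      deriv χ (Real.log ‖x‖) * (inner ℝ x v / ‖x‖ ^ 2) := by
  rcases eq_or_ne x 0 with rfl | hx
  · rw [(eventuallyEq_comp_log_norm_zero h0 hc).fderiv_eq]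
    simp
  · have hn : ‖x‖ ^ 2 ≠ 0 := by positivity
    have h1 := (((hasStrictFDerivAt_norm_sq x).hasFDerivAt).log hn).const_mul (1 / 2 : ℝ)
    have e : (fun y : E => 1 / 2 * Real.log (‖y‖ ^ 2)) = fun y => Real.log ‖y‖ := by
      ext y
      rw [Real.log_pow]
      push_cast
      ring
    rw [e] at h1
    have h2 := ((hχ (Real.log ‖x‖)).hasDerivAt.comp_hasFDerivAt x h1).fderiv
    have h3 := congrArg (fun T : E →L[ℝ] ℝ => T v) h2
    refine h3.trans ?_
    simp
    field_simp
    simp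

end RadialFunctions

/-! ### Divergence identity for radial vector fields. -/

section RadialIdentity

variable {N : ℕ}

lemma IsWeakGradient.hasWeakLineDeriv {u : EuclideanSpace ℝ (Fin N) → ℝ}
    {G : EuclideanSpace ℝ (Fin N) → EuclideanSpace ℝ (Fin N)} (h : IsWeakGradient u G)
    (v : EuclideanSpace ℝ (Fin N)) : HasWeakLineDeriv u (fun x => inner ℝ (G x) v) v :=
  fun φ hφ hφc => h.2.2 φ hφ hφc v

/-- The divergence identity for `u²` and the radial vector field `χ(log |x|) x`. -/
lemma IsWeakGradient.integral_sq_mul_radial_div {u : EuclideanSpace ℝ (Fin N) → ℝ}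
    {G : EuclideanSpace ℝ (Fin N) → EuclideanSpace ℝ (Fin N)} (h : IsWeakGradient u G)
    {U : Set (EuclideanSpace ℝ (Fin N))} (hU : IsOpen U)
    (hu2 : MemLp u 2 (volume.restrict U)) (hG2 : MemLp G 2 (volume.restrict U))
    {χ : ℝ → ℝ} (hχ : ContDiff ℝ ∞ χ) (h0' : 0 ∉ tsupport χ) (hc : HasCompactSupport χ)
    (hχU : (fun x => ‖x‖) ⁻¹' (Real.exp '' tsupport χ) ⊆ U) :
    ∫ x, u x ^ 2 * (N * χ (Real.log ‖x‖) + deriv χ (Real.log ‖x‖)) =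
      - ∫ x, 2 * (u x * inner ℝ (G x) x * χ (Real.log ‖x‖)) := by
  have h0 : χ 0 = 0 := image_eq_zero_of_notMem_tsupport h0'
  set f : EuclideanSpace ℝ (Fin N) → ℝ := fun x => χ (Real.log ‖x‖) with hf
  have hfs : ContDiff ℝ ∞ f := contDiff_comp_log_norm hχ h0 hc
  have hfc : HasCompactSupport f := hasCompactSupport_comp_log_norm h0 hc
  have hfU : tsupport f ⊆ U := (tsupport_comp_log_norm_subset h0 hc).trans hχU
  let e : Fin N → EuclideanSpace ℝ (Fin N) := fun i => EuclideanSpace.single i 1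
  -- These are the components of the field χ(log |x|) x; the chain rule is applied to each one in
  -- its own direction and summed.
  let φ : Fin N → EuclideanSpace ℝ (Fin N) → ℝ := fun i x => f x * x i
  have hφ : ∀ i, ContDiff ℝ ∞ (φ i) := fun i => hfs.mul (by fun_prop)
  have hφc : ∀ i, HasCompactSupport (φ i) := fun i => hfc.mul_right
  have hφU : ∀ i, tsupport (φ i) ⊆ U := fun i => (closure_mono
    (Function.support_mul_subset_left _ _)).trans hfU
  have hGi : ∀ i, MemLp (fun x => inner ℝ (G x) (e i)) 2 (volume.restrict U) := fun i =>
    hG2.inner_const (𝕜 := ℝ) _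
  have hGl : ∀ i, LocallyIntegrable (fun x => inner ℝ (G x) (e i)) := by
    intro i x
    obtain ⟨s, hs, hi⟩ := h.2.1 x
    exact ⟨s, hs, Integrable.inner_const hi _⟩
  have key := fun i => (h.hasWeakLineDeriv (e i)).sq_of_memLp_restrict h.1 (hGl i) hU hu2 (hGi i)
    (hφ i) (hφc i) (hφU i)
  have hd : ∀ i x, fderiv ℝ (φ i) x (e i) =
      deriv χ (Real.log ‖x‖) * (x i / ‖x‖ ^ 2) * x i + f x := by
    intro i x
    have hp : HasFDerivAt (fun y : EuclideanSpace ℝ (Fin N) => y i)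
        (EuclideanSpace.proj i : EuclideanSpace ℝ (Fin N) →L[ℝ] ℝ) x :=
      (EuclideanSpace.proj i : EuclideanSpace ℝ (Fin N) →L[ℝ] ℝ).hasFDerivAt
    have h1 := ((hfs.differentiable (by simp) x).hasFDerivAt.mul hp).fderiv
    have h2 := congrArg (fun T : EuclideanSpace ℝ (Fin N) →L[ℝ] ℝ => T (e i)) h1
    have h3 : fderiv ℝ f x (e i) = deriv χ (Real.log ‖x‖) * (x i / ‖x‖ ^ 2) := by
      rw [hf, fderiv_comp_log_norm (hχ.differentiable (by simp)) h0 hc]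
      simp [e, EuclideanSpace.inner_single_right]
    refine h2.trans ?_
    simp only [add_apply, smul_apply, h3, smul_eq_mul]
    simp [e]
    ring
  have hsum : ∀ x, ∑ i, fderiv ℝ (φ i) x (e i) = N * f x + deriv χ (Real.log ‖x‖) := by
    intro x
    simp_rw [hd]
    rw [Finset.sum_add_distrib]
    have : ∑ i, x i * x i = ‖x‖ ^ 2 := by
      rw [EuclideanSpace.real_norm_sq_eq]
      simp_rw [sq]
    have h1 : ∑ i, deriv χ (Real.log ‖x‖) * (x i / ‖x‖ ^ 2) * x i =
        deriv χ (Real.log ‖x‖) * (‖x‖ ^ 2 / ‖x‖ ^ 2) := by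
      rw [← this, Finset.sum_div, Finset.mul_sum]
      congr 1 with i
      rw [this]
      ring
    rw [h1]
    rcases eq_or_ne x 0 with rfl | hx
    · have : deriv χ 0 = 0 := by
        by_contra h
        exact h0' (support_deriv_subset h)
      simp [this, hf]
    · rw [div_self (by positivity)]
      simp
      ring
  have int : ∀ {w k : EuclideanSpace ℝ (Fin N) → ℝ}, IntegrableOn w U → Continuous k →
      HasCompactSupport k → (∀ x ∉ U, k x = 0) → Integrable fun x => w x * k x := by
    intro w k hw hk hkc hk0
    obtain ⟨M, hM⟩ := hk.bounded_above_of_compact_support hkc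
    rw [← integrableOn_iff_integrable_of_support_subset (s := U) fun x hx => by_contra fun hxU =>
      hx (by simp [hk0 x hxU])]
    exact hw.mul_bdd hk.aestronglyMeasurable (ae_of_all _ hM)
  have i1 : ∀ i, Integrable fun x => u x ^ 2 * fderiv ℝ (φ i) x (e i) := by
    intro i
    have hD : Continuous fun x => fderiv ℝ (φ i) x (e i) :=
      ((hφ i).continuous_fderiv (by simp)).clm_apply continuous_const
    refine int hu2.integrable_sq hD ((hφc i).fderiv_apply (𝕜 := ℝ) _) fun x hx => ?_
    have : fderiv ℝ (φ i) x = 0 :=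
      image_eq_zero_of_notMem_tsupport fun hx' => hx (hφU i (tsupport_fderiv_subset ℝ hx'))
    simp [this]
  have i2 : ∀ i, Integrable fun x => 2 * (u x * inner ℝ (G x) (e i) * φ i x) := by
    intro i
    refine (int (hu2.integrable_mul (hGi i)) (hφ i).continuous (hφc i) fun x hx => ?_).const_mul 2
    exact image_eq_zero_of_notMem_tsupport fun hx' => hx (hφU i hx')
  have := Finset.sum_congr (s₁ := Finset.univ) rfl fun i _ => key i
  rw [Finset.sum_neg_distrib, ← integral_finsetSum _ fun i _ => i1 i,
    ← integral_finsetSum _ fun i _ => i2 i] at this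
  simp_rw [← Finset.mul_sum, hsum] at this
  rw [this]
  congr 2 with x
  have h1 : ∀ i, inner ℝ (G x) (e i) = G x i := fun i => by
    simp [e, EuclideanSpace.inner_single_right]
  have h2 : inner ℝ (G x) x = ∑ i, G x i * x i := by
    rw [PiLp.inner_apply]
    simp [mul_comm]
  simp_rw [h1]
  rw [h2, Finset.mul_sum, Finset.mul_sum, Finset.sum_mul, Finset.mul_sum]
  congr 1 with i
  simp only [φ, hf]
  ring

end RadialIdentity

/-! ### The logarithmic weight. -/

section LogMeasure

open Filter Topology

variable {N : ℕ} {θ : EuclideanSpace ℝ (Fin N) → ℝ} {α : ℝ}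

lemma measurable_logDensity (hθ : Continuous θ) : Measurable (logDensity θ α) := by
  unfold logDensity
  exact hθ.measurable.mul
    ((Real.measurable_log.comp (measurable_norm.const_div 1)).pow_const α)

lemma logDensity_nonneg (hθ0 : ∀ x, 0 ≤ θ x)
    (hθout : ∀ x ∉ Metric.ball (0 : EuclideanSpace ℝ (Fin N)) 1, θ x = 0)
    (x : EuclideanSpace ℝ (Fin N)) : 0 ≤ logDensity θ α x := by
  unfold logDensity
  by_cases hx : x ∈ Metric.ball 0 1
  · refine mul_nonneg (hθ0 x) (Real.rpow_nonneg ?_ _)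
    rcases eq_or_ne x 0 with rfl | h0
    · simp
    · refine Real.log_nonneg ((one_le_div (norm_pos_iff.2 h0)).2 ?_)
      exact (mem_ball_zero_iff.1 hx).le
  · simp [hθout x hx]

lemma logDensity_of_norm_lt
    (hθin : ∀ x ∈ Metric.ball (0 : EuclideanSpace ℝ (Fin N)) (1 / 2), θ x = 1)
    {x : EuclideanSpace ℝ (Fin N)} (hx : ‖x‖ < 1 / 2) :
    logDensity θ α x = (-Real.log ‖x‖) ^ α := by
  rw [logDensity, hθin x (by simpa using hx), one_mul, one_div, Real.log_inv]

lemma integral_logMeasure (hθ : Continuous θ) (hθ0 : ∀ x, 0 ≤ θ x)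
    (hθout : ∀ x ∉ Metric.ball (0 : EuclideanSpace ℝ (Fin N)) 1, θ x = 0)
    (f : EuclideanSpace ℝ (Fin N) → ℝ) :
    ∫ x, f x ∂(logMeasure θ α) = ∫ x, logDensity θ α x * f x := by
  rw [logMeasure, integral_withDensity_eq_integral_toReal_smul
    (measurable_logDensity hθ).ennreal_ofReal (by simp)]
  congr 1 with x
  rw [ENNReal.toReal_ofReal (logDensity_nonneg hθ0 hθout x), smul_eq_mul]

lemma norm_lt_half_of_one_le_neg_log {E : Type*} [NormedAddCommGroup E] {x : E}
    (hx : 1 ≤ -Real.log ‖x‖) : ‖x‖ < 1 / 2 := by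
  have hx0 : x ≠ 0 := by
    rintro rfl
    simp at hx
    linarith
  have h1 : ‖x‖ = Real.exp (Real.log ‖x‖) := (Real.exp_log (norm_pos_iff.2 hx0)).symm
  have h2 : Real.exp (Real.log ‖x‖) ≤ Real.exp (-1) := Real.exp_le_exp.2 (by linarith)
  have h3 : Real.exp (-1) < 1 / 2 := by
    rw [Real.exp_neg, one_div]
    exact inv_strictAnti₀ (by norm_num) (by linarith [Real.exp_one_gt_d9])
  linarith

lemma exists_le_rpow_of_mem_Icc {a b : ℝ} (ha : 0 < a) (hab : a ≤ b) (α : ℝ) :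
    ∃ m : ℝ, 0 < m ∧ ∀ s ∈ Set.Icc a b, m ≤ s ^ α := by
  refine ⟨min (a ^ α) (b ^ α), by have := ha.trans_le hab; positivity, fun s hs => ?_⟩
  rcases le_total 0 α with h | h
  · exact (min_le_left _ _).trans (Real.rpow_le_rpow ha.le hs.1 h)
  · exact (min_le_right _ _).trans (Real.rpow_le_rpow_of_nonpos (ha.trans_le hs.1) hs.2 h)

/-- On the annulus θ = 1 and log(1/|x|) stays in a compact subset of (0, ∞), so the density is
bounded below there whatever the sign of α. -/
lemma MeasureTheory.MemLp.restrict_annulus_of_logMeasure {F : Type*} [NormedAddCommGroup F]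
    (hθin : ∀ x ∈ Metric.ball (0 : EuclideanSpace ℝ (Fin N)) (1 / 2), θ x = 1)
    {f : EuclideanSpace ℝ (Fin N) → F} {p : ENNReal} (hf : MemLp f p (logMeasure θ α))
    {δ : ℝ} (hδ : 0 < δ) :
    MemLp f p (volume.restrict {x | δ < ‖x‖ ∧ ‖x‖ < 1 / 2}) := by
  rcases le_or_gt (1 / 2) δ with h | h
  · have : {x : EuclideanSpace ℝ (Fin N) | δ < ‖x‖ ∧ ‖x‖ < 1 / 2} = ∅ := by
      ext x
      simp only [Set.mem_ofPred_eq, Set.mem_empty_iff_false, iff_false, not_and, not_lt]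
      exact fun h' => (h.trans_lt h').le
    rw [this, Measure.restrict_empty]
    simp
  set U := {x : EuclideanSpace ℝ (Fin N) | δ < ‖x‖ ∧ ‖x‖ < 1 / 2} with hU_def
  have hU : MeasurableSet U :=
    ((isOpen_lt continuous_const continuous_norm).inter
      (isOpen_lt continuous_norm continuous_const)).measurableSet
  have hlog : 0 < -Real.log (1 / 2) := by
    have := Real.log_neg (x := 1 / 2) (by norm_num) (by norm_num)
    linarith
  obtain ⟨m, hm, hms⟩ := exists_le_rpow_of_mem_Icc hlog
    (neg_le_neg (Real.log_le_log hδ h.le)) α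
  have hle : ENNReal.ofReal m • volume.restrict U ≤ logMeasure θ α := by
    rw [← withDensity_const, ← withDensity_indicator hU, logMeasure]
    refine withDensity_mono (ae_of_all _ fun x => ?_)
    by_cases hx : x ∈ U
    · have hx0 : 0 < ‖x‖ := hδ.trans hx.1
      simp only [Set.indicator_of_mem hx]
      rw [logDensity_of_norm_lt hθin hx.2]
      refine ENNReal.ofReal_le_ofReal (hms _ ⟨?_, ?_⟩)
      · exact neg_le_neg (Real.log_le_log hx0 hx.2.le)
      · exact neg_le_neg (Real.log_le_log hδ hx.1.le)
    · simp [Set.indicator_of_notMem hx]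
  have hm0 : ENNReal.ofReal m ≠ 0 := by simpa using hm
  refine hf.of_measure_le_smul (c := (ENNReal.ofReal m)⁻¹) (by simpa using hm) ?_
  calc volume.restrict U = (ENNReal.ofReal m)⁻¹ • (ENNReal.ofReal m • volume.restrict U) := by
        rw [smul_smul, ENNReal.inv_mul_cancel hm0 ENNReal.ofReal_ne_top, one_smul]
    _ ≤ _ := by gcongr

lemma contDiff_mul_rpow {a : ℝ → ℝ} (ha : ContDiff ℝ ∞ a) (ha1 : tsupport a ⊆ Set.Ici 1)
    (β : ℝ) : ContDiff ℝ ∞ fun s => a s * s ^ β := by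
  rw [contDiff_iff_contDiffAt]
  intro s
  by_cases hs : s ∈ tsupport a
  · have : s ≠ 0 := (zero_lt_one.trans_le (ha1 hs)).ne'
    exact ha.contDiffAt.mul (Real.contDiffAt_rpow_const_of_ne this)
  · refine (contDiffAt_const (c := (0 : ℝ))).congr_of_eventuallyEq ?_
    filter_upwards [notMem_tsupport_iff_eventuallyEq.1 hs] with t ht
    simp [ht]

lemma deriv_mul_rpow {a : ℝ → ℝ} (ha : ContDiff ℝ ∞ a) (ha1 : tsupport a ⊆ Set.Ici 1)
    (β s : ℝ) :
    deriv (fun s => a s * s ^ β) s = deriv a s * s ^ β + β * (a s * s ^ (β - 1)) := by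
  by_cases hs : s ∈ tsupport a
  · have hs0 : s ≠ 0 := (zero_lt_one.trans_le (ha1 hs)).ne'
    have h1 := ((ha.differentiable (by simp) s).hasDerivAt.mul
      (Real.hasDerivAt_rpow_const (p := β) (Or.inl hs0))).deriv
    exact h1.trans (by ring)
  · have h1 : a s = 0 := image_eq_zero_of_notMem_tsupport hs
    have h2 : deriv a s = 0 := by_contra fun h' => hs (support_deriv_subset h')
    have h3 : deriv (fun s => a s * s ^ β) s = 0 := by
      by_contra h'
      exact hs (closure_mono (Function.support_mul_subset_left _ _) (support_deriv_subset h'))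
    rw [h1, h2, h3]
    simp

/-- Away from the origin |x|^{-n} = e^{ns}, and b(s) e^{ns} is continuous with compact support. -/
lemma exists_bound_comp_neg_log_div_pow {b : ℝ → ℝ} (hb : Continuous b)
    (hbc : HasCompactSupport b) {n : ℕ} (hn : n ≠ 0) :
    ∃ M, ∀ x : EuclideanSpace ℝ (Fin N), |b (-Real.log ‖x‖) / ‖x‖ ^ n| ≤ M := by
  have hc : Continuous fun s => b s * Real.exp (n * s) := by fun_prop
  obtain ⟨M, hM⟩ := hc.bounded_above_of_compact_support hbc.mul_right
  refine ⟨M, fun x => ?_⟩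
  rcases eq_or_ne x 0 with rfl | hx
  · simpa [hn] using (abs_nonneg _).trans (hM 0)
  · have h := hM (-Real.log ‖x‖)
    rwa [mul_neg, Real.exp_neg, Real.exp_nat_mul, Real.exp_log (norm_pos_iff.2 hx),
      ← div_eq_mul_inv] at h

/-! ### Completing the square with a radial profile. -/

/-- The Hardy potential generated by the vector field `a(log (1 / |x|)) x / |x|²`. -/
noncomputable def hardyPotential (N : ℕ) (α : ℝ) (a : ℝ → ℝ) (s : ℝ) : ℝ :=
  (N - 2) * a s - deriv a s - α * (a s / s) - a s ^ 2

variable {a : ℝ → ℝ}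

lemma continuous_hardyPotential (ha : ContDiff ℝ ∞ a) (ha1 : tsupport a ⊆ Set.Ici 1) :
    Continuous (hardyPotential N α a) := by
  have h1 : Continuous fun s => a s / s := by
    simpa only [Real.rpow_neg_one, ← div_eq_mul_inv] using (contDiff_mul_rpow ha ha1 (-1)).continuous
  have h2 := ha.continuous
  have h3 : Continuous (deriv a) := ha.continuous_deriv (by simp)
  unfold hardyPotential
  fun_prop

lemma hasCompactSupport_hardyPotential (hac : HasCompactSupport a) :
    HasCompactSupport (hardyPotential N α a) := by
  refine hac.mono' fun s hs => by_contra fun h => hs ?_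
  have h1 : a s = 0 := image_eq_zero_of_notMem_tsupport h
  have h2 : deriv a s = 0 := by_contra fun h' => h (support_deriv_subset h')
  simp [hardyPotential, h1, h2]

/-- The weight and the factor |x|^{-2} are absorbed into χ, so that the unweighted divergence
identity applies. Differentiating e^{-2t} lowers N to N - 2, and differentiating (-t)^α creates the
term -αa/s. -/
lemma logDensity_mul_radial_div
    (hθin : ∀ x ∈ Metric.ball (0 : EuclideanSpace ℝ (Fin N)) (1 / 2), θ x = 1)
    (ha : ContDiff ℝ ∞ a) (ha1 : tsupport a ⊆ Set.Ici 1) {χ : ℝ → ℝ}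
    (hχ : χ = fun t => a (-t) * (-t) ^ α * Real.exp (-2 * t)) (x : EuclideanSpace ℝ (Fin N)) :
    χ (Real.log ‖x‖) = logDensity θ α x * (a (-Real.log ‖x‖) / ‖x‖ ^ 2) ∧
    N * χ (Real.log ‖x‖) + deriv χ (Real.log ‖x‖) = logDensity θ α x *
      ((hardyPotential N α a (-Real.log ‖x‖) + a (-Real.log ‖x‖) ^ 2) / ‖x‖ ^ 2) := by
  set s := -Real.log ‖x‖ with hs
  have hb := contDiff_mul_rpow ha ha1 α
  have hd : deriv χ (Real.log ‖x‖) = -(deriv (fun s => a s * s ^ α) s) *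
      Real.exp (-2 * Real.log ‖x‖) - 2 * (a s * s ^ α * Real.exp (-2 * Real.log ‖x‖)) := by
    have h0 : HasDerivAt (fun t => a (-t) * (-t) ^ α)
        ((-1 : ℝ) • deriv (fun s => a s * s ^ α) s) (Real.log ‖x‖) :=
      (hb.differentiable (by simp) s).hasDerivAt.scomp (Real.log ‖x‖) (hasDerivAt_neg' _)
    have h1 := h0.mul (((hasDerivAt_id (Real.log ‖x‖)).const_mul (-2)).exp)
    rw [hχ]
    refine h1.deriv.trans ?_
    simp [← hs]
    ring
  by_cases hmem : s ∈ tsupport a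
  · have hs1 : 1 ≤ s := ha1 hmem
    have hx : x ≠ 0 := by
      rintro rfl
      simp at hs
      linarith
    have hxp : 0 < ‖x‖ := norm_pos_iff.2 hx
    have hx2 : ‖x‖ < 1 / 2 := norm_lt_half_of_one_le_neg_log hs1
    have hexp : Real.exp (-2 * Real.log ‖x‖) = (‖x‖ ^ 2)⁻¹ := by
      rw [show -2 * Real.log ‖x‖ = -((2 : ℕ) * Real.log ‖x‖) by push_cast; ring, Real.exp_neg,
        Real.exp_nat_mul, Real.exp_log hxp]
    rw [hd, logDensity_of_norm_lt hθin hx2, deriv_mul_rpow ha ha1,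
      Real.rpow_sub_one (by linarith), hexp, hχ]
    simp only [← hs, hexp]
    refine ⟨by ring, ?_⟩
    unfold hardyPotential
    field_simp
    ring
  · have h1 : a s = 0 := image_eq_zero_of_notMem_tsupport hmem
    have h2 : deriv a s = 0 := by_contra fun h' => hmem (support_deriv_subset h')
    rw [hd, deriv_mul_rpow ha ha1, hχ]
    simp [← hs, h1, hardyPotential, h2]

lemma integrable_sq_mul_comp_neg_log_div {u : EuclideanSpace ℝ (Fin N) → ℝ}
    {μ : Measure (EuclideanSpace ℝ (Fin N))} (hu : MemLp u 2 μ) {b : ℝ → ℝ} (hb : Continuous b)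
    (hbc : HasCompactSupport b) :
    Integrable (fun x => u x ^ 2 * (b (-Real.log ‖x‖) / ‖x‖ ^ 2)) μ := by
  obtain ⟨M, hM⟩ := exists_bound_comp_neg_log_div_pow (N := N) hb hbc two_ne_zero
  exact hu.integrable_sq.mul_bdd (Measurable.aestronglyMeasurable (by fun_prop)) (ae_of_all _ hM)

/-- The weighted Hardy inequality with a general radial potential. -/
lemma MemWeightedH1.integral_sq_mul_hardyPotential_le (hθ : Continuous θ) (hθ0 : ∀ x, 0 ≤ θ x)
    (hθin : ∀ x ∈ Metric.ball (0 : EuclideanSpace ℝ (Fin N)) (1 / 2), θ x = 1)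
    (hθout : ∀ x ∉ Metric.ball (0 : EuclideanSpace ℝ (Fin N)) 1, θ x = 0)
    {u : EuclideanSpace ℝ (Fin N) → ℝ} {G : EuclideanSpace ℝ (Fin N) → EuclideanSpace ℝ (Fin N)}
    (h : MemWeightedH1 (logMeasure θ α) u G)
    (ha : ContDiff ℝ ∞ a) (hac : HasCompactSupport a) (ha1 : tsupport a ⊆ Set.Ici 1) :
    ∫ x, u x ^ 2 * (hardyPotential N α a (-Real.log ‖x‖) / ‖x‖ ^ 2) ∂(logMeasure θ α) ≤
      ∫ x, ‖G x‖ ^ 2 ∂(logMeasure θ α) := by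
  obtain ⟨hw, hu, hG⟩ := h
  set μ := logMeasure θ α with hμ
  have hacont := ha.continuous
  set χ : ℝ → ℝ := fun t => a (-t) * (-t) ^ α * Real.exp (-2 * t) with hχ
  have hχs : ContDiff ℝ ∞ χ := by
    have h1 : ContDiff ℝ ∞ fun t : ℝ => a (-t) * (-t) ^ α :=
      (contDiff_mul_rpow ha ha1 α).comp (contDiff_id.neg : ContDiff ℝ ∞ fun t : ℝ => -t)
    have h2 : ContDiff ℝ ∞ fun t : ℝ => Real.exp (-2 * t) := by fun_prop
    exact h1.mul h2
  have hχsupp : ∀ t ∈ tsupport χ, -t ∈ tsupport a := by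
    intro t ht
    have : tsupport χ ⊆ (fun t => -t) ⁻¹' tsupport a := by
      refine closure_minimal (fun t ht => subset_closure ?_)
        ((isClosed_tsupport a).preimage continuous_neg)
      intro h0
      exact ht (by simp [hχ, h0])
    exact this ht
  have hχc : HasCompactSupport χ := by
    refine (hac.comp_homeomorph (Homeomorph.neg ℝ)).mono fun t ht h0 => ht ?_
    have h1 : a (-t) = 0 := h0
    simp [hχ, h1]
  have hχ0 : 0 ∉ tsupport χ := fun h0 => by
    have := ha1 (hχsupp 0 h0)
    simp at this
    linarith
  obtain ⟨T, hT⟩ : ∃ T, ∀ s ∈ tsupport a, s < T := by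
    obtain ⟨T, hT⟩ := hac.isCompact.bddAbove
    exact ⟨T + 1, fun s hs => (hT hs).trans_lt (lt_add_one T)⟩
  set U := {x : EuclideanSpace ℝ (Fin N) | Real.exp (-T) < ‖x‖ ∧ ‖x‖ < 1 / 2}
  have hU : IsOpen U := (isOpen_lt continuous_const continuous_norm).inter
      (isOpen_lt continuous_norm continuous_const)
  have hχU : (fun x => ‖x‖) ⁻¹' (Real.exp '' tsupport χ) ⊆ U := by
    rintro x ⟨t, ht, htx⟩
    simp only at htx
    have h1 := ha1 (hχsupp t ht)
    have h2 := hT _ (hχsupp t ht)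
    simp only [Set.mem_Ici] at h1
    refine ⟨?_, ?_⟩
    · rw [← htx]
      exact Real.exp_lt_exp.2 (by linarith)
    · refine norm_lt_half_of_one_le_neg_log ?_
      rwa [← htx, Real.log_exp]
  have key := hw.integral_sq_mul_radial_div hU
    (hu.restrict_annulus_of_logMeasure hθin (Real.exp_pos _))
    (hG.restrict_annulus_of_logMeasure hθin (Real.exp_pos _)) hχs hχ0 hχc hχU
  have e1 : ∫ x, u x ^ 2 * (N * χ (Real.log ‖x‖) + deriv χ (Real.log ‖x‖)) =
      ∫ x, u x ^ 2 * ((hardyPotential N α a (-Real.log ‖x‖) + a (-Real.log ‖x‖) ^ 2) / ‖x‖ ^ 2)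
        ∂μ := by
    rw [hμ, integral_logMeasure hθ hθ0 hθout]
    congr 1 with x
    rw [(logDensity_mul_radial_div hθin ha ha1 hχ x).2]
    ring
  have e2 : ∫ x, 2 * (u x * inner ℝ (G x) x * χ (Real.log ‖x‖)) =
      ∫ x, 2 * (u x * (a (-Real.log ‖x‖) / ‖x‖ ^ 2 * inner ℝ (G x) x)) ∂μ := by
    rw [hμ, integral_logMeasure hθ hθ0 hθout]
    congr 1 with x
    rw [(logDensity_mul_radial_div hθin ha ha1 hχ x).1]
    ring
  rw [e1, e2] at key
  have i0 := integrable_sq_mul_comp_neg_log_div hu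
    (continuous_hardyPotential (N := N) (α := α) ha ha1) (hasCompactSupport_hardyPotential hac)
  have hsq : Continuous fun s => a s ^ 2 := by fun_prop
  have hsqc : HasCompactSupport fun s => a s ^ 2 := hac.mono fun s hs h0 => hs (by
    have h1 : a s = 0 := h0
    simp [h1])
  have i1 := integrable_sq_mul_comp_neg_log_div hu hsq hsqc
  have i2 : Integrable
      (fun x => 2 * (u x * (a (-Real.log ‖x‖) / ‖x‖ ^ 2 * inner ℝ (G x) x))) μ := by
    suffices hg : MemLp (fun x => a (-Real.log ‖x‖) / ‖x‖ ^ 2 * inner ℝ (G x) x) 2 μ from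
      (hu.integrable_mul hg).const_mul 2
    obtain ⟨M, hM⟩ := exists_bound_comp_neg_log_div_pow (N := N) hacont hac one_ne_zero
    have hm1 : Measurable fun x : EuclideanSpace ℝ (Fin N) => a (-Real.log ‖x‖) / ‖x‖ ^ 2 := by
      fun_prop
    have hm2 : AEStronglyMeasurable (fun x => inner ℝ (G x) x) μ :=
      AEStronglyMeasurable.inner (𝕜 := ℝ) hG.1 measurable_id.aestronglyMeasurable
    -- One of the two powers of |x| in the denominator is cancelled by Cauchy–Schwarz, hence the
    -- bound taken with exponent 1.
    refine hG.of_le_mul (c := M) (hm1.aestronglyMeasurable.mul hm2) (ae_of_all _ fun x => ?_)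
    rw [norm_mul, Real.norm_eq_abs]
    rcases eq_or_ne x 0 with rfl | hx
    · simpa using mul_nonneg ((abs_nonneg _).trans (hM 0)) (norm_nonneg (G 0))
    · have hxp : 0 < ‖x‖ := norm_pos_iff.2 hx
      calc |a (-Real.log ‖x‖) / ‖x‖ ^ 2| * ‖inner ℝ (G x) x‖
          ≤ |a (-Real.log ‖x‖) / ‖x‖ ^ 2| * (‖G x‖ * ‖x‖) := by
            gcongr
            exact norm_inner_le_norm _ _
        _ = |a (-Real.log ‖x‖) / ‖x‖ ^ 1| * ‖G x‖ := by
            rw [abs_div, abs_div, abs_of_pos (pow_pos hxp 2), abs_of_pos (pow_pos hxp 1)]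
            field_simp
        _ ≤ M * ‖G x‖ := by
            gcongr
            exact hM x
  have i3 : Integrable (fun x => ‖G x‖ ^ 2) μ := hG.integrable_norm_pow two_ne_zero
  -- The integrand is the square |G + u a(s) x/|x|²|².
  have hpos : 0 ≤ ∫ x, (‖G x‖ ^ 2 + 2 * (u x * (a (-Real.log ‖x‖) / ‖x‖ ^ 2 * inner ℝ (G x) x))
      + u x ^ 2 * (a (-Real.log ‖x‖) ^ 2 / ‖x‖ ^ 2)) ∂μ := by
    refine integral_nonneg fun x => ?_
    have h1 := norm_add_sq_real (G x) ((u x * (a (-Real.log ‖x‖) / ‖x‖ ^ 2)) • x)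
    rw [norm_smul, inner_smul_right, mul_pow, Real.norm_eq_abs, sq_abs] at h1
    have h2 : (u x * (a (-Real.log ‖x‖) / ‖x‖ ^ 2)) ^ 2 * ‖x‖ ^ 2 =
        u x ^ 2 * (a (-Real.log ‖x‖) ^ 2 / ‖x‖ ^ 2) := by
      rcases eq_or_ne x 0 with rfl | hx
      · simp
      · have hxp : 0 < ‖x‖ := norm_pos_iff.2 hx
        field_simp
    rw [h2] at h1
    have h3 := sq_nonneg ‖G x + (u x * (a (-Real.log ‖x‖) / ‖x‖ ^ 2)) • x‖
    simp only [Pi.zero_apply]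
    linarith
  have i4 : Integrable (fun x => ‖G x‖ ^ 2 +
      2 * (u x * (a (-Real.log ‖x‖) / ‖x‖ ^ 2 * inner ℝ (G x) x))) μ := i3.add i2
  rw [integral_add i4 i1, integral_add i3 i2] at hpos
  have e3 : ∫ x, u x ^ 2 * ((hardyPotential N α a (-Real.log ‖x‖) + a (-Real.log ‖x‖) ^ 2)
      / ‖x‖ ^ 2) ∂μ = (∫ x, u x ^ 2 * (hardyPotential N α a (-Real.log ‖x‖) / ‖x‖ ^ 2) ∂μ) +
      ∫ x, u x ^ 2 * (a (-Real.log ‖x‖) ^ 2 / ‖x‖ ^ 2) ∂μ := by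
    rw [← integral_add i0 i1]
    congr 1 with x
    ring
  linarith

end LogMeasure

/-! ### Truncated profiles and passage to the limit. -/

section HardyInequality

open Filter Topology

/-- A smooth radial profile, equal to `k` between `2` and `n` and supported in `[1, n + 1]`. -/
noncomputable def hardyProfile (k : ℝ) (n : ℕ) (s : ℝ) : ℝ :=
  k * (Real.smoothTransition (s - 1) * Real.smoothTransition (n + 1 - s))

lemma contDiff_hardyProfile (k : ℝ) (n : ℕ) : ContDiff ℝ ∞ (hardyProfile k n) :=
  contDiff_const.mul ((Real.smoothTransition.contDiff.comp (contDiff_id.sub contDiff_const)).mul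
    (Real.smoothTransition.contDiff.comp (contDiff_const.sub contDiff_id)))

lemma tsupport_hardyProfile_subset (k : ℝ) (n : ℕ) :
    tsupport (hardyProfile k n) ⊆ Set.Icc 1 (n + 1) := by
  refine closure_minimal (fun s hs => ?_) isClosed_Icc
  by_contra h
  refine hs ?_
  rw [Set.mem_Icc, not_and_or, not_le, not_le] at h
  unfold hardyProfile
  rcases h with h | h
  · rw [Real.smoothTransition.zero_of_nonpos (by linarith)]
    simp
  · rw [Real.smoothTransition.zero_of_nonpos (x := n + 1 - s) (by linarith)]
    simp

lemma deriv_smoothTransition_of_one_lt {x : ℝ} (hx : 1 < x) :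
    deriv Real.smoothTransition x = 0 := by
  have : Real.smoothTransition =ᶠ[𝓝 x] fun _ => 1 := by
    filter_upwards [lt_mem_nhds hx] with y hy
    exact Real.smoothTransition.one_of_one_le hy.le
  rw [this.deriv_eq, deriv_const]

lemma exists_deriv_smoothTransition_le :
    ∃ D, 0 ≤ D ∧ ∀ x, deriv Real.smoothTransition x ≤ D := by
  have hc : Continuous (deriv Real.smoothTransition) :=
    (Real.smoothTransition.contDiff (n := 1)).continuous_deriv le_rfl
  obtain ⟨D, hD⟩ := isCompact_Icc.exists_bound_of_continuousOn (s := Set.Icc (0 : ℝ) 1)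
    hc.continuousOn
  have hD0 : 0 ≤ D := (norm_nonneg _).trans (hD 0 (by simp))
  refine ⟨D, hD0, fun x => ?_⟩
  by_cases hx : x ∈ Set.Icc (0 : ℝ) 1
  · exact (le_abs_self _).trans (hD x hx)
  · suffices deriv Real.smoothTransition x = 0 by rwa [this]
    rw [Set.mem_Icc, not_and_or, not_le, not_le] at hx
    rcases hx with hx | hx
    · have : Real.smoothTransition =ᶠ[𝓝 x] fun _ => 0 := by
        filter_upwards [gt_mem_nhds hx] with y hy
        exact Real.smoothTransition.zero_of_nonpos hy.le
      rw [this.deriv_eq, deriv_const]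
    · exact deriv_smoothTransition_of_one_lt hx

lemma deriv_hardyProfile (k : ℝ) (n : ℕ) (s : ℝ) :
    deriv (hardyProfile k n) s =
      k * (deriv Real.smoothTransition (s - 1) * Real.smoothTransition (n + 1 - s) -
        Real.smoothTransition (s - 1) * deriv Real.smoothTransition (n + 1 - s)) := by
  have hd : Differentiable ℝ Real.smoothTransition :=
    (Real.smoothTransition.contDiff (n := 1)).differentiable (by simp)
  have h1 := (hd (s - 1)).hasDerivAt.comp s ((hasDerivAt_id s).sub_const 1)
  have h2 := (hd (n + 1 - s)).hasDerivAt.comp s ((hasDerivAt_id s).const_sub (n + 1 : ℝ))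
  refine ((h1.mul h2).const_mul k).deriv.trans ?_
  simp
  ring_nf
  simp

/-- Here e^{2s} stands for |x|^{-2}. The constant must precede n. The lower bound keeps only the
outer cutoff, which tends to 1 for every s as n grows; the loss from the inner cutoff sits in s < S
and goes into C. -/
lemma exists_le_hardyPotential_hardyProfile {N : ℕ} {α k c : ℝ} (hk : 0 ≤ k)
    (hkN : (N : ℝ) - 2 = 2 * k) (hc : c ≤ k ^ 2) (hα : α ≤ 0 ∨ c < k ^ 2) :
    ∃ C, 0 ≤ C ∧ ∀ (n : ℕ) (s : ℝ),
      c * Real.smoothTransition (n + 1 - s) * Real.exp (2 * s) - C ≤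
        hardyPotential N α (hardyProfile k n) s * Real.exp (2 * s) := by
  obtain ⟨D, hD0, hD⟩ := exists_deriv_smoothTransition_le
  -- Beyond S the term αk/s fits into the gap k² - c; the bound S ≥ 3 places s - 1 past the
  -- transition, where P = 1 and P' = 0.
  obtain ⟨S, hS3, hS⟩ : ∃ S : ℝ, 3 ≤ S ∧ ∀ s, S ≤ s → α * k / s ≤ k ^ 2 - c := by
    rcases hα with hα | hα
    · refine ⟨3, le_rfl, fun s hs => ?_⟩
      have : α * k / s ≤ 0 := div_nonpos_of_nonpos_of_nonneg
        (mul_nonpos_of_nonpos_of_nonneg hα hk) (by linarith)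
      linarith
    · refine ⟨max 3 (α * k / (k ^ 2 - c)), le_max_left _ _, fun s hs => ?_⟩
      have h1 : 0 < k ^ 2 - c := by linarith
      have h2 : 3 ≤ s := (le_max_left _ _).trans hs
      have h3 := (le_max_right _ _).trans hs
      rw [div_le_iff₀ (by linarith)]
      rw [div_le_iff₀ h1] at h3
      linarith
  have hC0 : 0 ≤ (k * D + |α| * k + |c|) * Real.exp (2 * S) := by positivity
  refine ⟨_, hC0, fun n s => ?_⟩
  have hmono : ∀ x, 0 ≤ deriv Real.smoothTransition x := fun x =>
    Real.smoothTransition.monotone.deriv_nonneg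
  have hform : hardyPotential N α (hardyProfile k n) s =
      2 * k * hardyProfile k n s - deriv (hardyProfile k n) s - α * (hardyProfile k n s / s) -
        hardyProfile k n s ^ 2 := by
    rw [hardyPotential, hkN]
  rw [hform, deriv_hardyProfile, hardyProfile]
  set P := Real.smoothTransition (s - 1) with hP
  set Q := Real.smoothTransition (n + 1 - s) with hQ
  set P' := deriv Real.smoothTransition (s - 1) with hP'
  set Q' := deriv Real.smoothTransition (n + 1 - s) with hQ'
  have hP0 : 0 ≤ P := Real.smoothTransition.nonneg _
  have hP1 : P ≤ 1 := Real.smoothTransition.le_one _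
  have hQ0 : 0 ≤ Q := Real.smoothTransition.nonneg _
  have hQ1 : Q ≤ 1 := Real.smoothTransition.le_one _
  have hPQ0 : 0 ≤ P * Q := mul_nonneg hP0 hQ0
  have hPQ1 : P * Q ≤ 1 := mul_le_one₀ hP1 hQ0 hQ1
  have hPQQ : P * Q ≤ Q := mul_le_of_le_one_left hQ0 hP1
  -- Two favourable signs: the derivative of the outer cutoff enters with a plus and is dropped, and
  -- (PQ)² ≤ PQ.
  have hlow : k ^ 2 * (P * Q) - k * (P' * Q) - α * k / s * (P * Q) ≤
      2 * k * (k * (P * Q)) - k * (P' * Q - P * Q') - α * (k * (P * Q) / s) -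
        (k * (P * Q)) ^ 2 := by
    have h1 : k ^ 2 * (P * Q) ^ 2 ≤ k ^ 2 * (P * Q) := by
      have : (P * Q) ^ 2 ≤ P * Q := by nlinarith
      exact mul_le_mul_of_nonneg_left this (sq_nonneg k)
    have h2 : 0 ≤ k * (P * Q') := mul_nonneg hk (mul_nonneg hP0 (hmono _))
    have h3 : α * (k * (P * Q) / s) = α * k / s * (P * Q) := by ring
    rw [h3]
    nlinarith
  refine le_trans ?_ (mul_le_mul_of_nonneg_right hlow (Real.exp_pos _).le)
  rcases le_or_gt S s with hs | hs
  · have e1 : P = 1 := Real.smoothTransition.one_of_one_le (by linarith)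
    have e2 : P' = 0 := deriv_smoothTransition_of_one_lt (by linarith)
    have h1 := hS s hs
    rw [e1, e2]
    have h2 : c * Q ≤ k ^ 2 * (1 * Q) - k * (0 * Q) - α * k / s * (1 * Q) := by nlinarith
    have := mul_le_mul_of_nonneg_right h2 (Real.exp_pos (2 * s)).le
    linarith
  · have hPs : -(|α| * k) ≤ -(α * k / s * (P * Q)) := by
      rcases le_or_gt s 1 with h1 | h1
      · have : P = 0 := Real.smoothTransition.zero_of_nonpos (by linarith)
        rw [this]
        simpa using by positivity
      · have h2 : α * k / s ≤ |α| * k := by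
          calc α * k / s ≤ |α| * k / s := by gcongr; exact le_abs_self α
            _ ≤ |α| * k := div_le_self (by positivity) h1.le
        have h3 : α * k / s * (P * Q) ≤ |α| * k * (P * Q) := mul_le_mul_of_nonneg_right h2 hPQ0
        have h4 : |α| * k * (P * Q) ≤ |α| * k * 1 :=
          mul_le_mul_of_nonneg_left hPQ1 (by positivity)
        linarith
    have hPD : k * (P' * Q) ≤ k * D := by
      refine mul_le_mul_of_nonneg_left ?_ hk
      calc P' * Q ≤ P' * 1 := mul_le_mul_of_nonneg_left hQ1 (hmono _)
        _ ≤ D := by rw [mul_one]; exact hD _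
    have hcQ : c * Q ≤ |c| := by
      calc c * Q ≤ |c| * Q := mul_le_mul_of_nonneg_right (le_abs_self c) hQ0
        _ ≤ |c| := mul_le_of_le_one_right (abs_nonneg c) hQ1
    have hk2 : 0 ≤ k ^ 2 * (P * Q) := by positivity
    have h1 : c * Q - (k ^ 2 * (P * Q) - k * (P' * Q) - α * k / s * (P * Q)) ≤
        k * D + |α| * k + |c| := by linarith
    have h2 := mul_le_mul_of_nonneg_right h1 (Real.exp_pos (2 * s)).le
    have h3 : (k * D + |α| * k + |c|) * Real.exp (2 * s) ≤
        (k * D + |α| * k + |c|) * Real.exp (2 * S) := by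
      gcongr
    linarith

/-- Fatou's lemma, giving integrability of the limit as a conclusion and not as an assumption. -/
lemma integrable_of_tendsto_of_integral_le {X : Type*} [MeasurableSpace X] {μ : Measure X}
    {f : ℕ → X → ℝ} {F : X → ℝ} {B : ℝ} (hf : ∀ n, Integrable (f n) μ) (h0 : ∀ n x, 0 ≤ f n x)
    (ht : ∀ x, Tendsto (fun n => f n x) atTop (𝓝 (F x))) (hB : ∀ n, ∫ x, f n x ∂μ ≤ B) :
    Integrable F μ ∧ ∫ x, F x ∂μ ≤ B := by
  have hF0 : ∀ x, 0 ≤ F x := fun x => ge_of_tendsto' (ht x) fun n => h0 n x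
  have hFm : AEStronglyMeasurable F μ :=
    aestronglyMeasurable_of_tendsto_ae atTop (fun n => (hf n).1) (ae_of_all _ ht)
  have hB0 : 0 ≤ B := (integral_nonneg (h0 0)).trans (hB 0)
  have hle : ∫⁻ x, ENNReal.ofReal (F x) ∂μ ≤ ENNReal.ofReal B := by
    calc ∫⁻ x, ENNReal.ofReal (F x) ∂μ
        = ∫⁻ x, liminf (fun n => ENNReal.ofReal (f n x)) atTop ∂μ := by
          congr 1 with x
          exact (((ENNReal.continuous_ofReal.tendsto _).comp (ht x)).liminf_eq).symm
      _ ≤ liminf (fun n => ∫⁻ x, ENNReal.ofReal (f n x) ∂μ) atTop :=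
          lintegral_liminf_le' fun n => (hf n).1.aemeasurable.ennreal_ofReal
      _ ≤ ENNReal.ofReal B := by
          refine (liminf_le_liminf (v := fun _ => ENNReal.ofReal B)
            (Eventually.of_forall fun n => ?_)).trans_eq (by simp)
          rw [← ofReal_integral_eq_lintegral_ofReal (hf n) (ae_of_all _ (h0 n))]
          exact ENNReal.ofReal_le_ofReal (hB n)
  refine ⟨⟨hFm, ?_⟩, ?_⟩
  · rw [hasFiniteIntegral_iff_ofReal (ae_of_all _ hF0)]
    exact hle.trans_lt ENNReal.ofReal_lt_top
  · rw [integral_eq_lintegral_of_nonneg_ae (ae_of_all _ hF0) hFm]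
    exact ENNReal.toReal_le_of_le_ofReal hB0 hle

/-- The weighted Hardy inequality with remainder, together with the finiteness of its left-hand
side. -/
theorem exists_integrable_and_hardy {N : ℕ} {θ : EuclideanSpace ℝ (Fin N) → ℝ} {α k c : ℝ}
    (hθ : Continuous θ) (hθ0 : ∀ x, 0 ≤ θ x)
    (hθin : ∀ x ∈ Metric.ball (0 : EuclideanSpace ℝ (Fin N)) (1 / 2), θ x = 1)
    (hθout : ∀ x ∉ Metric.ball (0 : EuclideanSpace ℝ (Fin N)) 1, θ x = 0)
    (hk : 0 ≤ k) (hkN : (N : ℝ) - 2 = 2 * k) (hc0 : 0 < c) (hc : c ≤ k ^ 2)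
    (hα : α ≤ 0 ∨ c < k ^ 2) :
    ∃ C, 0 ≤ C ∧ ∀ u G, MemWeightedH1 (logMeasure θ α) u G →
      Integrable (fun x => u x ^ 2 / ‖x‖ ^ 2) (logMeasure θ α) ∧
      c * ∫ x, u x ^ 2 / ‖x‖ ^ 2 ∂(logMeasure θ α) ≤
        (∫ x, ‖G x‖ ^ 2 ∂(logMeasure θ α)) + C * ∫ x, u x ^ 2 ∂(logMeasure θ α) := by
  obtain ⟨C, hC0, hC⟩ := exists_le_hardyPotential_hardyProfile hk hkN hc hα
  refine ⟨C, hC0, fun u G h => ?_⟩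
  set μ := logMeasure θ α with hμ
  -- A bounded truncation of |x|^{-2}: it vanishes for s ≥ n + 1 and agrees with |x|^{-2} for s ≤ n.
  let q : ℕ → EuclideanSpace ℝ (Fin N) → ℝ := fun n x =>
    Real.smoothTransition (n + 1 - -Real.log ‖x‖) / ‖x‖ ^ 2
  have hexp : ∀ x : EuclideanSpace ℝ (Fin N), x ≠ 0 →
      Real.exp (2 * -Real.log ‖x‖) = (‖x‖ ^ 2)⁻¹ := fun x hx => by
    rw [mul_neg, Real.exp_neg, show (2 : ℝ) = (2 : ℕ) by norm_num, Real.exp_nat_mul,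
      Real.exp_log (norm_pos_iff.2 hx)]
  have hq0 : ∀ n x, 0 ≤ q n x := fun n x =>
    div_nonneg (Real.smoothTransition.nonneg _) (sq_nonneg _)
  have hqle : ∀ n x, q n x ≤ Real.exp (2 * (n + 1)) := by
    intro n x
    rcases eq_or_ne x 0 with rfl | hx
    · simpa [q] using (Real.exp_pos _).le
    rcases le_or_gt (-Real.log ‖x‖) (n + 1) with h1 | h1
    · calc q n x ≤ 1 / ‖x‖ ^ 2 := by
            simp only [q]
            gcongr
            exact Real.smoothTransition.le_one _
        _ = Real.exp (2 * -Real.log ‖x‖) := by rw [hexp x hx, one_div]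
        _ ≤ _ := Real.exp_le_exp.2 (by linarith)
    · simp only [q]
      rw [Real.smoothTransition.zero_of_nonpos (by linarith), zero_div]
      exact (Real.exp_pos _).le
  have hqm : ∀ n, Measurable (q n) := fun n =>
    (Real.smoothTransition.continuous.measurable.comp (by fun_prop)).div (by fun_prop)
  have hqt : ∀ x, Tendsto (fun n => u x ^ 2 * q n x) atTop (𝓝 (u x ^ 2 / ‖x‖ ^ 2)) := by
    intro x
    obtain ⟨n₀, hn₀⟩ := exists_nat_ge (-Real.log ‖x‖)
    refine tendsto_const_nhds.congr' ?_
    filter_upwards [eventually_ge_atTop n₀] with n hn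
    have : (n₀ : ℝ) ≤ n := by exact_mod_cast hn
    simp only [q]
    rw [Real.smoothTransition.one_of_one_le (by linarith)]
    ring
  have hu2 : Integrable (fun x => u x ^ 2) μ := h.2.1.integrable_sq
  have hqi : ∀ n, Integrable (fun x => u x ^ 2 * q n x) μ := fun n =>
    hu2.mul_bdd (hqm n).aestronglyMeasurable (ae_of_all _ fun x => by
      rw [Real.norm_eq_abs, abs_of_nonneg (hq0 n x)]
      exact hqle n x)
  have hbound : ∀ n, ∫ x, u x ^ 2 * q n x ∂μ ≤
      ((∫ x, ‖G x‖ ^ 2 ∂μ) + C * ∫ x, u x ^ 2 ∂μ) / c := by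
    intro n
    have ha := contDiff_hardyProfile k n
    have hsub := tsupport_hardyProfile_subset k n
    have hac : HasCompactSupport (hardyProfile k n) :=
      isCompact_Icc.of_isClosed_subset (isClosed_tsupport _) hsub
    have ha1 : tsupport (hardyProfile k n) ⊆ Set.Ici 1 := hsub.trans Set.Icc_subset_Ici_self
    have h1 := h.integral_sq_mul_hardyPotential_le hθ hθ0 hθin hθout ha hac ha1
    have i1 := integrable_sq_mul_comp_neg_log_div h.2.1
      (continuous_hardyPotential (N := N) (α := α) ha ha1) (hasCompactSupport_hardyPotential hac)
    have h2 : ∫ x, (c * (u x ^ 2 * q n x) - C * u x ^ 2) ∂μ ≤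
        ∫ x, u x ^ 2 * (hardyPotential N α (hardyProfile k n) (-Real.log ‖x‖) / ‖x‖ ^ 2) ∂μ := by
      refine integral_mono (((hqi n).const_mul c).sub (hu2.const_mul C)) i1 fun x => ?_
      have hx : c * q n x - C ≤
          hardyPotential N α (hardyProfile k n) (-Real.log ‖x‖) / ‖x‖ ^ 2 := by
        rcases eq_or_ne x 0 with rfl | hx
        · simpa [q] using hC0
        · have := hC n (-Real.log ‖x‖)
          rw [hexp x hx, ← div_eq_mul_inv, ← div_eq_mul_inv] at this
          simpa only [q, mul_div_assoc] using this
      calc c * (u x ^ 2 * q n x) - C * u x ^ 2 = u x ^ 2 * (c * q n x - C) := by ring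
        _ ≤ _ := mul_le_mul_of_nonneg_left hx (sq_nonneg _)
    rw [integral_sub ((hqi n).const_mul c) (hu2.const_mul C), integral_const_mul,
      integral_const_mul] at h2
    rw [le_div_iff₀ hc0]
    linarith
  obtain ⟨hint, hle⟩ := integrable_of_tendsto_of_integral_le hqi
    (fun n x => mul_nonneg (sq_nonneg _) (hq0 n x)) hqt hbound
  refine ⟨hint, ?_⟩
  rw [le_div_iff₀ hc0] at hle
  linarith

end HardyInequality

/-! ### Radial test functions and reduction to one dimension. -/

section Sharpness

open Filter Topology

lemma integral_Ioi_zero_eq_integral_exp_neg (f : ℝ → ℝ) :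
    ∫ r in Set.Ioi (0 : ℝ), f r = ∫ s, Real.exp (-s) * f (Real.exp (-s)) := by
  have himage : (fun s : ℝ => Real.exp (-s)) '' Set.univ = Set.Ioi 0 := by
    ext r
    simp only [Set.image_univ, Set.mem_range, Set.mem_Ioi]
    refine ⟨fun ⟨s, hs⟩ => hs ▸ Real.exp_pos _, fun hr => ⟨-Real.log r, ?_⟩⟩
    rw [neg_neg, Real.exp_log hr]
  have hd : ∀ s : ℝ, HasDerivAt (fun s : ℝ => Real.exp (-s)) (-Real.exp (-s)) s := fun s => by
    simpa using (hasDerivAt_neg' s).exp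
  rw [← himage, integral_image_eq_integral_abs_deriv_smul MeasurableSet.univ
    (fun s _ => (hd s).hasDerivWithinAt) fun s _ t _ h => neg_injective (Real.exp_injective h)]
  simp

/-- Polar coordinates followed by r = e^{-s}; the factor e^{-Ns} collects r^{N-1} and dr. -/
lemma integral_comp_neg_log_norm {E : Type*} [NormedAddCommGroup E] [InnerProductSpace ℝ E]
    [FiniteDimensional ℝ E] [MeasurableSpace E] [BorelSpace E] [Nontrivial E] (b : ℝ → ℝ) :
    ∫ x : E, b (-Real.log ‖x‖) = Module.finrank ℝ E * volume.real (Metric.ball (0 : E) 1) *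
      ∫ s, b s * Real.exp (-(Module.finrank ℝ E * s)) := by
  rw [integral_fun_norm_addHaar volume (fun r => b (-Real.log r)),
    integral_Ioi_zero_eq_integral_exp_neg]
  simp only [Real.log_exp, neg_neg, smul_eq_mul, nsmul_eq_mul, mul_assoc]
  congr 3 with s
  have hpos : 0 < Module.finrank ℝ E := Module.finrank_pos
  rw [← mul_assoc, ← Real.exp_nat_mul, ← Real.exp_add, mul_comm]
  congr 2
  push_cast [Nat.cast_sub (Nat.one_le_iff_ne_zero.2 hpos.ne')]
  ring

variable {N : ℕ} {θ : EuclideanSpace ℝ (Fin N) → ℝ} {α : ℝ}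

lemma logDensity_mul_comp_neg_log
    (hθin : ∀ x ∈ Metric.ball (0 : EuclideanSpace ℝ (Fin N)) (1 / 2), θ x = 1)
    {b : ℝ → ℝ} (hb1 : tsupport b ⊆ Set.Ici 1) (x : EuclideanSpace ℝ (Fin N)) :
    logDensity θ α x * b (-Real.log ‖x‖) = b (-Real.log ‖x‖) * (-Real.log ‖x‖) ^ α := by
  by_cases hs : -Real.log ‖x‖ ∈ tsupport b
  · have hs1 : 1 ≤ -Real.log ‖x‖ := hb1 hs
    rw [logDensity_of_norm_lt hθin (norm_lt_half_of_one_le_neg_log hs1), mul_comm]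
  · rw [image_eq_zero_of_notMem_tsupport hs]
    simp

lemma integrable_comp_neg_log_logMeasure (hθ : Continuous θ) (hθ0 : ∀ x, 0 ≤ θ x)
    (hθin : ∀ x ∈ Metric.ball (0 : EuclideanSpace ℝ (Fin N)) (1 / 2), θ x = 1)
    (hθout : ∀ x ∉ Metric.ball (0 : EuclideanSpace ℝ (Fin N)) 1, θ x = 0)
    {b : ℝ → ℝ} (hb : ContDiff ℝ ∞ b) (hbc : HasCompactSupport b)
    (hb1 : tsupport b ⊆ Set.Ici 1) :
    Integrable (fun x => b (-Real.log ‖x‖)) (logMeasure θ α) := by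
  rw [logMeasure, integrable_withDensity_iff (measurable_logDensity hθ).ennreal_ofReal (by simp)]
  have hb0 : b 0 = 0 := image_eq_zero_of_notMem_tsupport fun h0 => by
    have := hb1 h0
    simp at this
    linarith
  set χ : ℝ → ℝ := fun t => b (-t) * (-t) ^ α with hχdef
  have hχ0 : χ 0 = 0 := by simp [hχdef, hb0]
  have hχc : HasCompactSupport χ :=
    (hbc.comp_homeomorph (Homeomorph.neg ℝ)).mono fun t ht h0 => ht (by
      have h1 : b (-t) = 0 := h0
      simp [hχdef, h1])
  have hχ : ContDiff ℝ ∞ χ :=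
    (contDiff_mul_rpow hb hb1 α).comp (contDiff_id.neg : ContDiff ℝ ∞ fun t : ℝ => -t)
  have h1 : Integrable fun x : EuclideanSpace ℝ (Fin N) => χ (Real.log ‖x‖) :=
    (contDiff_comp_log_norm hχ hχ0 hχc).continuous.integrable_of_hasCompactSupport
      (hasCompactSupport_comp_log_norm hχ0 hχc)
  refine h1.congr (ae_of_all _ fun x => ?_)
  simp only
  rw [ENNReal.toReal_ofReal (logDensity_nonneg hθ0 hθout x), mul_comm (b _) (logDensity θ α x),
    logDensity_mul_comp_neg_log hθin hb1]

lemma integral_comp_neg_log_logMeasure (hN : N ≠ 0) (hθ : Continuous θ) (hθ0 : ∀ x, 0 ≤ θ x)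
    (hθin : ∀ x ∈ Metric.ball (0 : EuclideanSpace ℝ (Fin N)) (1 / 2), θ x = 1)
    (hθout : ∀ x ∉ Metric.ball (0 : EuclideanSpace ℝ (Fin N)) 1, θ x = 0)
    {b : ℝ → ℝ} (hb1 : tsupport b ⊆ Set.Ici 1) :
    ∫ x, b (-Real.log ‖x‖) ∂(logMeasure θ α) =
      N * volume.real (Metric.ball (0 : EuclideanSpace ℝ (Fin N)) 1) *
        ∫ s, b s * s ^ α * Real.exp (-(N * s)) := by
  have : Nonempty (Fin N) := ⟨⟨0, Nat.pos_of_ne_zero hN⟩⟩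
  rw [integral_logMeasure hθ hθ0 hθout]
  simp_rw [logDensity_mul_comp_neg_log hθin hb1]
  rw [integral_comp_neg_log_norm fun s => b s * s ^ α]
  simp

lemma tsupport_subset_of_eq_zero {b g : ℝ → ℝ} (hb : ∀ s, s ∉ tsupport g → b s = 0) :
    tsupport b ⊆ tsupport g :=
  closure_minimal (fun s hs => by_contra fun h' => hs (hb s h')) (isClosed_tsupport g)

lemma isWeakGradient_of_contDiff {u : EuclideanSpace ℝ (Fin N) → ℝ}
    {G : EuclideanSpace ℝ (Fin N) → EuclideanSpace ℝ (Fin N)} (hu : ContDiff ℝ ∞ u)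
    (huc : HasCompactSupport u) (hG : Continuous G)
    (hfd : ∀ x v, fderiv ℝ u x v = inner ℝ (G x) v) : IsWeakGradient u G := by
  refine ⟨hu.continuous.locallyIntegrable, hG.locallyIntegrable, fun φ hφ hφc v => ?_⟩
  have hDu : Continuous fun x => fderiv ℝ u x v :=
    (hu.continuous_fderiv (by simp)).clm_apply continuous_const
  have hDφ : Continuous fun x => fderiv ℝ φ x v :=
    (hφ.continuous_fderiv (by simp)).clm_apply continuous_const
  have i1 : Integrable fun x => fderiv ℝ u x v * φ x :=
    (hDu.mul hφ.continuous).integrable_of_hasCompactSupport hφc.mul_left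
  have i2 : Integrable fun x => u x * fderiv ℝ φ x v :=
    (hu.continuous.mul hDφ).integrable_of_hasCompactSupport huc.mul_right
  have i3 : Integrable fun x => u x * φ x :=
    (hu.continuous.mul hφ.continuous).integrable_of_hasCompactSupport hφc.mul_left
  rw [integral_mul_fderiv_eq_neg_fderiv_mul_of_integrable i1 i2 i3
    (fun x _ => hu.differentiable (by simp) x) (fun x _ => hφ.differentiable (by simp) x)]
  simp_rw [hfd]

/-- The radial test function `|x|^{-k} g(log (1 / |x|))` and its gradient. -/
lemma memWeightedH1_radial {k : ℝ} (hθ : Continuous θ) (hθ0 : ∀ x, 0 ≤ θ x)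
    (hθin : ∀ x ∈ Metric.ball (0 : EuclideanSpace ℝ (Fin N)) (1 / 2), θ x = 1)
    (hθout : ∀ x ∉ Metric.ball (0 : EuclideanSpace ℝ (Fin N)) 1, θ x = 0)
    {g : ℝ → ℝ} (hg : ContDiff ℝ ∞ g) (hgc : HasCompactSupport g)
    (hg1 : tsupport g ⊆ Set.Ici 1) :
    ∃ u G, MemWeightedH1 (logMeasure θ α) u G ∧
      (∀ x, u x ^ 2 = g (-Real.log ‖x‖) ^ 2 * Real.exp (2 * k * -Real.log ‖x‖)) ∧
      (∀ x, u x ^ 2 / ‖x‖ ^ 2 =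
        g (-Real.log ‖x‖) ^ 2 * Real.exp ((2 * k + 2) * -Real.log ‖x‖)) ∧
      (∀ x, ‖G x‖ ^ 2 = (k * g (-Real.log ‖x‖) + deriv g (-Real.log ‖x‖)) ^ 2 *
        Real.exp ((2 * k + 2) * -Real.log ‖x‖)) := by
  -- The test function in the variable t = log |x|; its gradient is ψ'(t) x/|x|², which explains the
  -- factor e^{-2t} in χ below.
  set ψ : ℝ → ℝ := fun t => g (-t) * Real.exp (-k * t) with hψdef
  have hψ : ContDiff ℝ ∞ ψ := by
    have h1 : ContDiff ℝ ∞ fun t : ℝ => g (-t) :=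
      hg.comp (contDiff_id.neg : ContDiff ℝ ∞ fun t : ℝ => -t)
    have h2 : ContDiff ℝ ∞ fun t : ℝ => Real.exp (-k * t) := by fun_prop
    exact h1.mul h2
  have hg0 : (0 : ℝ) ∉ tsupport g := fun h0 => by
    have := hg1 h0
    simp at this
    linarith
  have hgz : g 0 = 0 := image_eq_zero_of_notMem_tsupport hg0
  have hgz' : deriv g 0 = 0 := by_contra fun h' => hg0 (support_deriv_subset h')
  have hψ0 : ψ 0 = 0 := by simp [hψdef, hgz]
  have hψc : HasCompactSupport ψ :=
    (hgc.comp_homeomorph (Homeomorph.neg ℝ)).mono fun t ht h0 => ht (by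
      have h1 : g (-t) = 0 := h0
      simp [hψdef, h1])
  have hdψ : ∀ t, deriv ψ t = -(k * g (-t) + deriv g (-t)) * Real.exp (-k * t) := by
    intro t
    have h0 : HasDerivAt (fun t => g (-t)) ((-1 : ℝ) • deriv g (-t)) t :=
      (hg.differentiable (by simp) (-t)).hasDerivAt.scomp t (hasDerivAt_neg' _)
    have h1 := h0.mul (((hasDerivAt_id t).const_mul (-k)).exp)
    refine h1.deriv.trans ?_
    simp
    ring
  set χ : ℝ → ℝ := fun t => deriv ψ t * Real.exp (-2 * t) with hχdef
  have hdψs : ContDiff ℝ ∞ (deriv ψ) := (contDiff_infty_iff_deriv.1 hψ).2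
  have hχ : ContDiff ℝ ∞ χ := by
    have h2 : ContDiff ℝ ∞ fun t : ℝ => Real.exp (-2 * t) := by fun_prop
    exact hdψs.mul h2
  have hχ0 : χ 0 = 0 := by simp [hχdef, hdψ, hgz, hgz']
  have hχc : HasCompactSupport χ := hψc.deriv.mono fun t ht h0 => ht (by
    have h1 : deriv ψ t = 0 := h0
    simp [hχdef, h1])
  have hexp : ∀ (n : ℕ) (x : EuclideanSpace ℝ (Fin N)), x ≠ 0 →
      Real.exp (n * -Real.log ‖x‖) = (‖x‖ ^ n)⁻¹ := fun n x hx => by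
    rw [mul_neg, Real.exp_neg, Real.exp_nat_mul, Real.exp_log (norm_pos_iff.2 hx)]
  set u : EuclideanSpace ℝ (Fin N) → ℝ := fun x => ψ (Real.log ‖x‖) with hudef
  set G : EuclideanSpace ℝ (Fin N) → EuclideanSpace ℝ (Fin N) :=
    fun x => χ (Real.log ‖x‖) • x with hGdef
  have hu : ContDiff ℝ ∞ u := contDiff_comp_log_norm hψ hψ0 hψc
  have huc : HasCompactSupport u := hasCompactSupport_comp_log_norm hψ0 hψc
  have hG : Continuous G := (contDiff_comp_log_norm hχ hχ0 hχc).continuous.smul continuous_id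
  have hfd : ∀ x v, fderiv ℝ u x v = inner ℝ (G x) v := by
    intro x v
    rw [hudef, fderiv_comp_log_norm (hψ.differentiable (by simp)) hψ0 hψc, hGdef]
    simp only [inner_smul_left, conj_trivial, hχdef]
    rcases eq_or_ne x 0 with rfl | hx
    · simp
    · have := hexp 2 x hx
      rw [show -2 * Real.log ‖x‖ = (2 : ℕ) * -Real.log ‖x‖ by push_cast; ring, this]
      ring
  have e1 : ∀ x, u x ^ 2 = g (-Real.log ‖x‖) ^ 2 * Real.exp (2 * k * -Real.log ‖x‖) := by
    intro x
    simp only [hudef, hψdef]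
    rw [mul_pow, ← Real.exp_nat_mul]
    congr 2
    push_cast
    ring
  have e2 : ∀ x, u x ^ 2 / ‖x‖ ^ 2 =
      g (-Real.log ‖x‖) ^ 2 * Real.exp ((2 * k + 2) * -Real.log ‖x‖) := by
    intro x
    rw [e1]
    rcases eq_or_ne x 0 with rfl | hx
    · simp [hgz]
    · have := hexp 2 x hx
      push_cast at this
      rw [add_mul, Real.exp_add, this]
      ring
  have e3 : ∀ x, ‖G x‖ ^ 2 = (k * g (-Real.log ‖x‖) + deriv g (-Real.log ‖x‖)) ^ 2 *
      Real.exp ((2 * k + 2) * -Real.log ‖x‖) := by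
    intro x
    rcases eq_or_ne x 0 with rfl | hx
    · simp [hGdef, hgz, hgz']
    · have hxp : 0 < ‖x‖ := norm_pos_iff.2 hx
      have h2 := hexp 2 x hx
      push_cast at h2
      have h3 : Real.exp (-2 * Real.log ‖x‖) = (‖x‖ ^ 2)⁻¹ := by
        rw [← h2]
        ring_nf
      have h4 : Real.exp (-k * Real.log ‖x‖) ^ 2 = Real.exp (2 * k * -Real.log ‖x‖) := by
        rw [← Real.exp_nat_mul]
        push_cast
        ring_nf
      simp only [hGdef, norm_smul, mul_pow, Real.norm_eq_abs, sq_abs, hχdef, hdψ]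
      rw [add_mul, Real.exp_add, h2, h3, h4]
      field_simp
  have hgn : ∀ s, s ∉ tsupport g → g s = 0 := fun s hs => image_eq_zero_of_notMem_tsupport hs
  have hgn' : ∀ s, s ∉ tsupport g → deriv g s = 0 := fun s hs =>
    by_contra fun h' => hs (support_deriv_subset h')
  have hdg : ContDiff ℝ ∞ (deriv g) := (contDiff_infty_iff_deriv.1 hg).2
  refine ⟨u, G, ⟨isWeakGradient_of_contDiff hu huc hG hfd, ?_, ?_⟩, e1, e2, e3⟩
  · rw [memLp_two_iff_integrable_sq hu.continuous.aestronglyMeasurable]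
    have h1 : tsupport (fun s => g s ^ 2 * Real.exp (2 * k * s)) ⊆ tsupport g :=
      tsupport_subset_of_eq_zero fun s hs => by simp [hgn s hs]
    have h2 : ContDiff ℝ ∞ fun s => g s ^ 2 * Real.exp (2 * k * s) := by fun_prop
    have h3 : HasCompactSupport (fun s => g s ^ 2 * Real.exp (2 * k * s)) :=
      hgc.isCompact.of_isClosed_subset (isClosed_tsupport _) h1
    have h4 := integrable_comp_neg_log_logMeasure (α := α) hθ hθ0 hθin hθout h2 h3 (h1.trans hg1)
    exact h4.congr (ae_of_all _ fun x => (e1 x).symm)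
  · rw [memLp_two_iff_integrable_sq_norm hG.aestronglyMeasurable]
    have h1 : tsupport (fun s => (k * g s + deriv g s) ^ 2 * Real.exp ((2 * k + 2) * s)) ⊆
        tsupport g := tsupport_subset_of_eq_zero fun s hs => by simp [hgn s hs, hgn' s hs]
    have h2 : ContDiff ℝ ∞ fun s => (k * g s + deriv g s) ^ 2 * Real.exp ((2 * k + 2) * s) := by
      fun_prop
    have h3 : HasCompactSupport (fun s => (k * g s + deriv g s) ^ 2 * Real.exp ((2 * k + 2) * s)) :=
      hgc.isCompact.of_isClosed_subset (isClosed_tsupport _) h1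
    have h4 := integrable_comp_neg_log_logMeasure (α := α) hθ hθ0 hθin hθout h2 h3 (h1.trans hg1)
    exact h4.congr (ae_of_all _ fun x => (e3 x).symm)

/-- The one-dimensional inequality obtained from the weighted Hardy inequality by testing it with
radial functions. -/
lemma WeightedHardy.integral_sq_mul_rpow_le {k c C : ℝ} (hN : N ≠ 0)
    (hkN : (N : ℝ) = 2 * k + 2) (hθ : Continuous θ) (hθ0 : ∀ x, 0 ≤ θ x)
    (hθin : ∀ x ∈ Metric.ball (0 : EuclideanSpace ℝ (Fin N)) (1 / 2), θ x = 1)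
    (hθout : ∀ x ∉ Metric.ball (0 : EuclideanSpace ℝ (Fin N)) 1, θ x = 0)
    (h : WeightedHardy (logMeasure θ α) c C) {g : ℝ → ℝ} (hg : ContDiff ℝ ∞ g)
    (hgc : HasCompactSupport g) (hg1 : tsupport g ⊆ Set.Ici 1) :
    c * ∫ s, g s ^ 2 * s ^ α ≤ (∫ s, (k * g s + deriv g s) ^ 2 * s ^ α) +
      C * ∫ s, g s ^ 2 * s ^ α * Real.exp (-2 * s) := by
  obtain ⟨u, G, hu, hu1, hu2, hu3⟩ := memWeightedH1_radial (α := α) (k := k) hθ hθ0 hθin hθout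
    hg hgc hg1
  have hle := h u G hu
  simp_rw [hu2, hu1, hu3] at hle
  have hsub : ∀ {b : ℝ → ℝ}, (∀ s, s ∉ tsupport g → b s = 0) → tsupport b ⊆ Set.Ici 1 := by
    intro b hb
    exact (tsupport_subset_of_eq_zero hb).trans hg1
  have hg0 : ∀ s, s ∉ tsupport g → g s = 0 := fun s hs => image_eq_zero_of_notMem_tsupport hs
  have hg0' : ∀ s, s ∉ tsupport g → deriv g s = 0 := fun s hs =>
    by_contra fun h' => hs (support_deriv_subset h')
  rw [integral_comp_neg_log_logMeasure hN hθ hθ0 hθin hθout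
      (b := fun s => g s ^ 2 * Real.exp (2 * k * s)) (hsub fun s hs => by simp [hg0 s hs]),
    integral_comp_neg_log_logMeasure hN hθ hθ0 hθin hθout
      (b := fun s => g s ^ 2 * Real.exp ((2 * k + 2) * s)) (hsub fun s hs => by simp [hg0 s hs]),
    integral_comp_neg_log_logMeasure hN hθ hθ0 hθin hθout
      (b := fun s => (k * g s + deriv g s) ^ 2 * Real.exp ((2 * k + 2) * s))
      (hsub fun s hs => by simp [hg0 s hs, hg0' s hs])] at hle
  have hω : 0 < N * volume.real (Metric.ball (0 : EuclideanSpace ℝ (Fin N)) 1) := by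
    refine mul_pos (by exact_mod_cast Nat.pos_of_ne_zero hN) ?_
    exact ENNReal.toReal_pos (Metric.measure_ball_pos _ _ one_pos).ne' measure_ball_lt_top.ne
  -- With the critical power |x|^{-k} the exponent 2k + 2 = N cancels the volume factor exactly; the
  -- zeroth-order term keeps e^{-2s}.
  have e1 : ∀ f : ℝ → ℝ, ∀ s, f s * Real.exp ((2 * k + 2) * s) * s ^ α * Real.exp (-(N * s)) =
      f s * s ^ α := by
    intro f s
    rw [hkN, Real.exp_neg]
    field_simp
  have e2 : ∀ s, g s ^ 2 * Real.exp (2 * k * s) * s ^ α * Real.exp (-(N * s)) =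
      g s ^ 2 * s ^ α * Real.exp (-2 * s) := by
    intro s
    have : Real.exp (-2 * s) = Real.exp (2 * k * s) * Real.exp (-(N * s)) := by
      rw [← Real.exp_add, hkN]
      ring_nf
    rw [this]
    ring
  simp_rw [e1 (fun s => g s ^ 2), e1 (fun s => (k * g s + deriv g s) ^ 2), e2] at hle
  refine le_of_mul_le_mul_left ?_ hω
  linarith

end Sharpness

/-! ### Dilation in the logarithmic variable and optimality of the constant. -/

section Sharpness

open Filter Topology

/-- Vanishing below 1 restricts to positive s, where the real power is multiplicative. -/
lemma integral_comp_div_mul_rpow {f : ℝ → ℝ} (hf : ∀ t < 1, f t = 0) {l : ℝ} (hl : 0 < l)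
    (α : ℝ) : ∫ s, f (s / l) * s ^ α = l ^ α * l * ∫ t, f t * t ^ α := by
  have h1 : ∀ s, f (s / l) * s ^ α = l ^ α * (fun t => f t * t ^ α) (s / l) := by
    intro s
    rcases lt_or_ge (s / l) 1 with h | h
    · simp [hf _ h]
    · have hs : s = l * (s / l) := by field_simp
      conv_lhs => rw [hs, Real.mul_rpow hl.le (by linarith)]
      rw [← hs]
      ring
  simp_rw [h1]
  rw [integral_const_mul, Measure.integral_comp_div (fun t => f t * t ^ α), abs_of_pos hl,
    smul_eq_mul, mul_assoc]

lemma continuous_mul_mul_rpow {f h : ℝ → ℝ} (hh : ContDiff ℝ ∞ h) (hh1 : tsupport h ⊆ Set.Ici 1)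
    (hf : Continuous f) (β : ℝ) : Continuous fun t => f t * h t * t ^ β := by
  simp_rw [mul_assoc]
  exact hf.mul (contDiff_mul_rpow hh hh1 β).continuous

lemma integral_sq_profile_pos {h : ℝ → ℝ} (hh : ContDiff ℝ ∞ h) (hhc : HasCompactSupport h)
    (hh1 : tsupport h ⊆ Set.Ici 1) {t₀ : ℝ} (ht₀ : h t₀ ≠ 0) (β : ℝ) :
    0 < ∫ t, h t ^ 2 * t ^ β := by
  have hc : Continuous fun t => h t ^ 2 * t ^ β := by
    simpa only [sq] using continuous_mul_mul_rpow hh hh1 hh.continuous β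
  have hcs : HasCompactSupport fun t => h t ^ 2 * t ^ β := hhc.mono fun t ht h0 => ht (by
    have h1 : h t = 0 := h0
    simp [h1])
  refine hc.integral_pos_of_hasCompactSupport_nonneg_nonzero (x := t₀) hcs (fun t => ?_) ?_
  · by_cases ht : t ∈ tsupport h
    · exact mul_nonneg (sq_nonneg _) (Real.rpow_nonneg (zero_le_one.trans (hh1 ht)) _)
    · simp [image_eq_zero_of_notMem_tsupport ht]
  · have : 0 < t₀ := zero_lt_one.trans_le (hh1 (subset_closure ht₀))
    have : 0 < t₀ ^ β := Real.rpow_pos_of_pos this β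
    positivity

/-- The derivative of h² t^α has integral zero. This is the source of the first-order term that
separates α > 0 from α ≤ 0. -/
lemma integral_mul_deriv_mul_rpow {h : ℝ → ℝ} (hh : ContDiff ℝ ∞ h) (hhc : HasCompactSupport h)
    (hh1 : tsupport h ⊆ Set.Ici 1) (α : ℝ) :
    2 * ∫ t, h t * deriv h t * t ^ α = -(α * ∫ t, h t ^ 2 * t ^ (α - 1)) := by
  have hh2 : ContDiff ℝ ∞ fun t => h t ^ 2 := hh.pow 2
  have hsub : tsupport (fun t => h t ^ 2) ⊆ tsupport h :=
    tsupport_subset_of_eq_zero fun s hs => by simp [image_eq_zero_of_notMem_tsupport hs]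
  have hF := contDiff_mul_rpow hh2 (hsub.trans hh1) α
  have hFc : HasCompactSupport fun t => h t ^ 2 * t ^ α := hhc.mono fun t ht h0 => ht (by
    have h1 : h t = 0 := h0
    simp [h1])
  have hdh : Continuous (deriv h) := hh.continuous_deriv (by simp)
  have hcs : ∀ f : ℝ → ℝ, Continuous f → (∀ t, h t = 0 → f t = 0) → Integrable f := by
    intro f hf h0
    exact hf.integrable_of_hasCompactSupport (hhc.mono fun t ht h1 => ht (h0 t h1))
  have i1 : Integrable fun t => h t * deriv h t * t ^ α := by
    refine hcs _ ?_ fun t ht => by simp [ht]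
    simpa only [mul_comm (h _)] using continuous_mul_mul_rpow hh hh1 hdh α
  have i2 : Integrable fun t => h t ^ 2 * t ^ (α - 1) := by
    refine hcs _ ?_ fun t ht => by simp [ht]
    simpa only [sq] using continuous_mul_mul_rpow hh hh1 hh.continuous (α - 1)
  have hd : ∀ t, deriv (fun t => h t ^ 2 * t ^ α) t =
      2 * (h t * deriv h t * t ^ α) + α * (h t ^ 2 * t ^ (α - 1)) := by
    intro t
    rw [deriv_mul_rpow hh2 (hsub.trans hh1), deriv_fun_pow (hh.differentiable (by simp) t)]
    push_cast
    ring
  have hz : ∫ t, deriv (fun t => h t ^ 2 * t ^ α) t = 0 :=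
    integral_eq_zero_of_hasDerivAt_of_integrable
      (fun t => (hF.differentiable (by simp) t).hasDerivAt)
      ((hF.continuous_deriv (by simp)).integrable_of_hasCompactSupport hFc.deriv)
      (hF.continuous.integrable_of_hasCompactSupport hFc)
  simp_rw [hd] at hz
  rw [integral_add (i1.const_mul 2) (i2.const_mul α), integral_const_mul, integral_const_mul] at hz
  linarith

variable {N : ℕ} {θ : EuclideanSpace ℝ (Fin N) → ℝ} {α : ℝ}

/-- Testing the weighted Hardy inequality with functions concentrating at the origin at the
logarithmic scale `l`. -/
lemma WeightedHardy.exists_quadratic_bound {k c C : ℝ} (hN : N ≠ 0)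
    (hkN : (N : ℝ) = 2 * k + 2) (hθ : Continuous θ) (hθ0 : ∀ x, 0 ≤ θ x)
    (hθin : ∀ x ∈ Metric.ball (0 : EuclideanSpace ℝ (Fin N)) (1 / 2), θ x = 1)
    (hθout : ∀ x ∉ Metric.ball (0 : EuclideanSpace ℝ (Fin N)) 1, θ x = 0)
    (hW : WeightedHardy (logMeasure θ α) c C) :
    ∃ A B M : ℝ, 0 < A ∧ 0 < B ∧ 0 ≤ M ∧
      ∀ l, 1 ≤ l → (c - k ^ 2) * A * l ^ 2 + k * α * B * l ≤ M := by
  obtain ⟨h, hh, hhc, hh1, t₀, ht₀⟩ : ∃ h : ℝ → ℝ, ContDiff ℝ ∞ h ∧ HasCompactSupport h ∧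
      tsupport h ⊆ Set.Ici 1 ∧ ∃ t₀, h t₀ ≠ 0 := by
    have hsub := tsupport_hardyProfile_subset 1 1
    refine ⟨hardyProfile 1 1, contDiff_hardyProfile 1 1,
      isCompact_Icc.of_isClosed_subset (isClosed_tsupport _) hsub,
      hsub.trans Set.Icc_subset_Ici_self, 3 / 2, ?_⟩
    have h1 := Real.smoothTransition.pos_of_pos (x := 3 / 2 - 1) (by norm_num)
    have h2 := Real.smoothTransition.pos_of_pos (x := ((1 : ℕ) : ℝ) + 1 - 3 / 2) (by norm_num)
    rw [hardyProfile]
    positivity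
  have hdh : Continuous (deriv h) := hh.continuous_deriv (by simp)
  have hdhs : ContDiff ℝ ∞ (deriv h) := (contDiff_infty_iff_deriv.1 hh).2
  have hdh1 : tsupport (deriv h) ⊆ Set.Ici 1 := (tsupport_deriv_subset (𝕜 := ℝ)).trans hh1
  have hz : ∀ t < 1, h t = 0 := fun t ht =>
    image_eq_zero_of_notMem_tsupport fun h' => not_le.2 ht (hh1 h')
  have hz' : ∀ t < 1, deriv h t = 0 := fun t ht =>
    image_eq_zero_of_notMem_tsupport fun h' => not_le.2 ht (hdh1 h')
  have i1 : Integrable fun t => h t ^ 2 * t ^ α := by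
    have hc : Continuous fun t => h t ^ 2 * t ^ α := by
      simpa only [sq] using continuous_mul_mul_rpow hh hh1 hh.continuous α
    exact hc.integrable_of_hasCompactSupport (hhc.mono fun t ht h0 => ht (by
      have h1 : h t = 0 := h0
      simp [h1]))
  have i2 : Integrable fun t => h t * deriv h t * t ^ α := by
    have hc : Continuous fun t => h t * deriv h t * t ^ α :=
      continuous_mul_mul_rpow hdhs hdh1 hh.continuous α
    exact hc.integrable_of_hasCompactSupport (hhc.mono fun t ht h0 => ht (by
      have h1 : h t = 0 := h0
      simp [h1]))
  have i3 : Integrable fun t => deriv h t ^ 2 * t ^ α := by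
    have hc : Continuous fun t => deriv h t ^ 2 * t ^ α := by
      simpa only [sq] using continuous_mul_mul_rpow hdhs hdh1 hdh α
    exact hc.integrable_of_hasCompactSupport (hhc.deriv.mono fun t ht h0 => ht (by
      have h1 : deriv h t = 0 := h0
      simp [h1]))
  set A := ∫ t, h t ^ 2 * t ^ α with hA
  set B := ∫ t, h t ^ 2 * t ^ (α - 1) with hB
  set D := ∫ t, deriv h t ^ 2 * t ^ α with hD
  have hA0 : 0 < A := integral_sq_profile_pos hh hhc hh1 ht₀ α
  have hD0 : 0 ≤ D := by
    refine integral_nonneg fun t => ?_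
    rcases lt_or_ge t 1 with ht | ht
    · simp [hz' t ht]
    · exact mul_nonneg (sq_nonneg _) (Real.rpow_nonneg (by linarith) _)
  refine ⟨A, B, D + |C| * A, hA0, integral_sq_profile_pos hh hhc hh1 ht₀ _, by positivity,
    fun l hl => ?_⟩
  have hl0 : 0 < l := by linarith
  have hdiv : ContDiff ℝ ∞ fun s : ℝ => s / l := contDiff_id.div_const l
  set g : ℝ → ℝ := fun s => h (s / l) with hg
  have hgs : ContDiff ℝ ∞ g := hh.comp hdiv
  have hgc : HasCompactSupport g := by
    have := hhc.comp_homeomorph (Homeomorph.mulRight₀ l⁻¹ (by positivity))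
    simpa [Function.comp_def, ← div_eq_mul_inv] using this
  have hg1 : tsupport g ⊆ Set.Ici 1 := by
    refine closure_minimal (fun s hs => ?_) isClosed_Ici
    by_contra hs1
    refine hs (hz _ ?_)
    rw [div_lt_one hl0]
    exact (not_le.1 hs1).trans_le hl
  have hdg : ∀ s, deriv g s = deriv h (s / l) / l := by
    intro s
    have h1 := ((hh.differentiable (by simp) (s / l)).hasDerivAt.comp s
      ((hasDerivAt_id s).div_const l)).deriv
    refine h1.trans ?_
    simp [div_eq_mul_inv]
  have key := hW.integral_sq_mul_rpow_le hN hkN hθ hθ0 hθin hθout hgs hgc hg1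
  simp_rw [hdg] at key
  have s1 : ∫ s, g s ^ 2 * s ^ α = l ^ α * l * A :=
    integral_comp_div_mul_rpow (f := fun t => h t ^ 2) (fun t ht => by simp [hz t ht]) hl0 α
  have s2 : ∫ s, (k * g s + deriv h (s / l) / l) ^ 2 * s ^ α =
      l ^ α * l * ∫ t, (k * h t + deriv h t / l) ^ 2 * t ^ α :=
    integral_comp_div_mul_rpow (f := fun t => (k * h t + deriv h t / l) ^ 2)
      (fun t ht => by simp [hz t ht, hz' t ht]) hl0 α
  have s3 : ∫ s, g s ^ 2 * s ^ α * Real.exp (-2 * s) =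
      l ^ α * l * ∫ t, h t ^ 2 * Real.exp (-2 * (l * t)) * t ^ α := by
    rw [← integral_comp_div_mul_rpow (f := fun t => h t ^ 2 * Real.exp (-2 * (l * t)))
      (fun t ht => by simp [hz t ht]) hl0 α]
    congr 1 with s
    rw [mul_div_cancel₀ s hl0.ne']
    ring
  have e2 : ∫ t, (k * h t + deriv h t / l) ^ 2 * t ^ α =
      k ^ 2 * A - k * α * B / l + D / l ^ 2 := by
    have hI := integral_mul_deriv_mul_rpow hh hhc hh1 α
    have : ∀ t, (k * h t + deriv h t / l) ^ 2 * t ^ α = k ^ 2 * (h t ^ 2 * t ^ α) +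
        2 * k / l * (h t * deriv h t * t ^ α) + 1 / l ^ 2 * (deriv h t ^ 2 * t ^ α) := by
      intro t
      field_simp
      ring
    simp_rw [this]
    have i4 : Integrable fun t => k ^ 2 * (h t ^ 2 * t ^ α) +
        2 * k / l * (h t * deriv h t * t ^ α) := (i1.const_mul _).add (i2.const_mul _)
    rw [integral_add i4 (i3.const_mul _),
      integral_add (i1.const_mul _) (i2.const_mul _), integral_const_mul, integral_const_mul,
      integral_const_mul, ← hA, ← hD,
      show 2 * k / l * ∫ t, h t * deriv h t * t ^ α =
        k / l * (2 * ∫ t, h t * deriv h t * t ^ α) by ring, hI]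
    ring
  -- On the support t ≥ 1, so e^{lt} ≥ l; the zeroth-order term is thus no larger in order than the
  -- D/l² term, whatever the sign of C.
  have e3 : C * ∫ t, h t ^ 2 * Real.exp (-2 * (l * t)) * t ^ α ≤ |C| * A / l ^ 2 := by
    have hpos : ∀ t, 0 ≤ h t ^ 2 * t ^ α := by
      intro t
      rcases lt_or_ge t 1 with ht | ht
      · simp [hz t ht]
      · exact mul_nonneg (sq_nonneg _) (Real.rpow_nonneg (by linarith) _)
    have h0 : 0 ≤ ∫ t, h t ^ 2 * Real.exp (-2 * (l * t)) * t ^ α :=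
      integral_nonneg fun t => by
        have := mul_nonneg (hpos t) (Real.exp_pos (-2 * (l * t))).le
        simp only [Pi.zero_apply]
        linarith
    have hle : ∫ t, h t ^ 2 * Real.exp (-2 * (l * t)) * t ^ α ≤
        ∫ t, 1 / l ^ 2 * (h t ^ 2 * t ^ α) := by
      refine integral_mono_of_nonneg (ae_of_all _ fun t => ?_) (i1.const_mul _)
        (ae_of_all _ fun t => ?_)
      · have := mul_nonneg (hpos t) (Real.exp_pos (-2 * (l * t))).le
        simp only [Pi.zero_apply]
        linarith
      · simp only
        rcases lt_or_ge t 1 with ht | ht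
        · simp [hz t ht]
        · have hlt : Real.exp (-2 * (l * t)) ≤ 1 / l ^ 2 := by
            have h1 : l ≤ Real.exp (l * t) := by
              have := Real.add_one_le_exp (l * t)
              nlinarith
            have h2 : Real.exp (-2 * (l * t)) = 1 / Real.exp (l * t) ^ 2 := by
              rw [← Real.exp_nat_mul, one_div, ← Real.exp_neg]
              congr 1
              push_cast
              ring
            rw [h2]
            gcongr
          calc _ = Real.exp (-2 * (l * t)) * (h t ^ 2 * t ^ α) := by ring
            _ ≤ _ := mul_le_mul_of_nonneg_right hlt (hpos t)
    rw [integral_const_mul, ← hA] at hle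
    calc C * ∫ t, h t ^ 2 * Real.exp (-2 * (l * t)) * t ^ α
        ≤ |C| * ∫ t, h t ^ 2 * Real.exp (-2 * (l * t)) * t ^ α :=
          mul_le_mul_of_nonneg_right (le_abs_self C) h0
      _ ≤ |C| * (1 / l ^ 2 * A) := mul_le_mul_of_nonneg_left hle (abs_nonneg C)
      _ = _ := by ring
  rw [s1, s2, s3, e2] at key
  have hK : 0 < l ^ α * l := by positivity
  have h1 : c * A ≤ (k ^ 2 * A - k * α * B / l + D / l ^ 2) + |C| * A / l ^ 2 := by
    refine le_trans (le_of_mul_le_mul_left (a := l ^ α * l) ?_ hK) (add_le_add_right e3 _)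
    linarith
  have h2 := mul_le_mul_of_nonneg_right h1 (sq_nonneg l)
  have h3 : (k ^ 2 * A - k * α * B / l + D / l ^ 2 + |C| * A / l ^ 2) * l ^ 2 =
      k ^ 2 * A * l ^ 2 - k * α * B * l + D + |C| * A := by
    field_simp
  linarith

lemma WeightedHardy.le_sq {k c C : ℝ} (hN : N ≠ 0)
    (hkN : (N : ℝ) = 2 * k + 2) (hθ : Continuous θ) (hθ0 : ∀ x, 0 ≤ θ x)
    (hθin : ∀ x ∈ Metric.ball (0 : EuclideanSpace ℝ (Fin N)) (1 / 2), θ x = 1)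
    (hθout : ∀ x ∉ Metric.ball (0 : EuclideanSpace ℝ (Fin N)) 1, θ x = 0)
    (hW : WeightedHardy (logMeasure θ α) c C) : c ≤ k ^ 2 := by
  obtain ⟨A, B, M, hA, hB, hM, hbound⟩ :=
    hW.exists_quadratic_bound hN hkN hθ hθ0 hθin hθout
  by_contra! hc
  have hd : 0 < (c - k ^ 2) * A := mul_pos (by linarith) hA
  set d := (c - k ^ 2) * A
  -- Chosen so that dl = d + M + |kαB|: the quadratic term then beats both the linear term and M.
  set l := 1 + (M + |k * α * B|) / d with hl
  have hl1 : 1 ≤ l := by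
    have : 0 ≤ (M + |k * α * B|) / d := by positivity
    linarith
  have h1 := hbound l hl1
  have h2 : d * l = d + M + |k * α * B| := by
    rw [hl]
    field_simp
    ring
  have h3 : d * l ^ 2 = (d + M + |k * α * B|) * l := by rw [← h2]; ring
  have h4 := neg_abs_le (k * α * B)
  nlinarith

lemma WeightedHardy.lt_sq {k c C : ℝ} (hN : N ≠ 0) (hk : 0 < k)
    (hkN : (N : ℝ) = 2 * k + 2) (hθ : Continuous θ) (hθ0 : ∀ x, 0 ≤ θ x)
    (hθin : ∀ x ∈ Metric.ball (0 : EuclideanSpace ℝ (Fin N)) (1 / 2), θ x = 1)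
    (hθout : ∀ x ∉ Metric.ball (0 : EuclideanSpace ℝ (Fin N)) 1, θ x = 0) (hα : 0 < α)
    (hW : WeightedHardy (logMeasure θ α) c C) : c < k ^ 2 := by
  obtain ⟨A, B, M, hA, hB, hM, hbound⟩ :=
    hW.exists_quadratic_bound hN hkN hθ hθ0 hθin hθout
  by_contra! hc
  have hd : 0 < k * α * B := by positivity
  set d := k * α * B
  have hl1 : 1 ≤ 1 + M / d := by
    have : 0 ≤ M / d := by positivity
    linarith
  have h1 := hbound _ hl1
  have h2 : d * (1 + M / d) = d + M := by
    field_simp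
  have h3 : 0 ≤ (c - k ^ 2) * A * (1 + M / d) ^ 2 := by
    have : 0 ≤ c - k ^ 2 := by linarith
    positivity
  linarith

end Sharpness

theorem mainTheorem10 (N : ℕ) (hN : 3 ≤ N) (θ : EuclideanSpace ℝ (Fin N) → ℝ)
    (hθ : ContDiff ℝ ∞ θ) (hθc : HasCompactSupport θ)
    (hθ01 : ∀ x, 0 ≤ θ x ∧ θ x ≤ 1)
    (hθin : ∀ x ∈ Metric.ball (0 : EuclideanSpace ℝ (Fin N)) (1 / 2), θ x = 1)
    (hθout : ∀ x ∉ Metric.ball (0 : EuclideanSpace ℝ (Fin N)) 1, θ x = 0)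
    (α : ℝ) :
    (∀ u G, MemWeightedH1 (logMeasure θ α) u G →
      Integrable (fun x => u x ^ 2 / ‖x‖ ^ 2) (logMeasure θ α)) ∧
    (α ≤ 0 →
      (∃ C : ℝ, 0 ≤ C ∧ WeightedHardy (logMeasure θ α) (hardyConst N) C) ∧
      (∀ c : ℝ, hardyConst N < c → ¬ ∃ C : ℝ, WeightedHardy (logMeasure θ α) c C)) ∧
    (0 < α →
      (∀ c : ℝ, c < hardyConst N →
        ∃ C : ℝ, 0 ≤ C ∧ WeightedHardy (logMeasure θ α) c C) ∧
      (∀ c : ℝ, hardyConst N ≤ c → ¬ ∃ C : ℝ, WeightedHardy (logMeasure θ α) c C)) := by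
  have hN' : (3 : ℝ) ≤ N := by exact_mod_cast hN
  have hN0 : N ≠ 0 := by omega
  set k : ℝ := ((N : ℝ) - 2) / 2 with hk_def
  have hk : 0 < k := by rw [hk_def]; linarith
  have hkN : (N : ℝ) - 2 = 2 * k := by rw [hk_def]; ring
  have hkN' : (N : ℝ) = 2 * k + 2 := by linarith
  have hconst : hardyConst N = k ^ 2 := rfl
  have hθ0 : ∀ x, 0 ≤ θ x := fun x => (hθ01 x).1
  have hk2 : 0 < k ^ 2 := by positivity
  have hardy := fun {c : ℝ} (hc0 : 0 < c) (hc : c ≤ k ^ 2) (hα : α ≤ 0 ∨ c < k ^ 2) =>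
    exists_integrable_and_hardy hθ.continuous hθ0 hθin hθout hk.le hkN hc0 hc hα
  rw [hconst]
  refine ⟨fun u G h => ?_, fun hα => ⟨?_, ?_⟩, fun hα => ⟨fun c hc => ?_, ?_⟩⟩
  -- A constant strictly below k² serves both signs of α.
  · obtain ⟨C, -, hC⟩ := hardy (c := k ^ 2 / 2) (by linarith) (by linarith)
      (Or.inr (by linarith))
    exact (hC u G h).1
  · obtain ⟨C, hC0, hC⟩ := hardy hk2 le_rfl (Or.inl hα)
    exact ⟨C, hC0, fun u G h => (hC u G h).2⟩
  · rintro c hc ⟨C, hW⟩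
    exact not_le.2 hc (hW.le_sq hN0 hkN' hθ.continuous hθ0 hθin hθout)
  -- The preceding result needs a positive constant; an arbitrary c is raised to one, which only
  -- strengthens the inequality.
  · have hlt : max c (k ^ 2 / 2) < k ^ 2 := max_lt hc (by linarith)
    obtain ⟨C, hC0, hC⟩ := hardy (lt_max_of_lt_right (by linarith)) hlt.le (Or.inr hlt)
    refine ⟨C, hC0, fun u G h => le_trans ?_ (hC u G h).2⟩
    exact mul_le_mul_of_nonneg_right (le_max_left _ _)
      (integral_nonneg fun x => div_nonneg (sq_nonneg _) (sq_nonneg _))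
  · rintro c hc ⟨C, hW⟩
    exact not_lt.2 hc (hW.lt_sq hN0 hk hkN' hθ.continuous hθ0 hθin hθout hα)
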